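/- For an integer $m\ge 1$ let $K=\mathbb{Q}(\zeta_m)$, with ring of integers $\mathcal{O}_K$ and discriminant $d_K$, and let $K_{\mathbb R}=K\otimes_{\mathbb Q}\mathbb{R}$ be the Euclidean space of dimension $\varphi(m)$ with scalar product induced by the trace form $\mathrm{Tr}(x\overline{y})$. Equip $E_m=K_{\mathbb R}^2$, of dimension $n=2\varphi(m)$, with the sum scalar product. For a Euclidean space $E$ of dimension $n$ and a lattice $\Lambda\subset E$ (a discrete subgroup spanning $E$), let $\Lambda^\#=\{x\in E:\langle x,y\rangle\in\mathbb{Z}\text{ for all }y\in\Lambda\}$ be the dual lattice, let $\mu$ be the least norm of a nonzero vector of $\Lambda$, and let $\Delta(\Lambda)=\mathrm{Vol}(B(\mu))/(2^n\,\mathrm{Vol}(\Lambda))$ be the packing density, where $B(\mu)$ is the closed ball of radius $\mu$ and $\mathrm{Vol}(\Lambda)$ is the covolume. The lattice $\Lambda$ is called symplectic if there is an isometry $\sigma$ of $E$ with $\sigma(\Lambda)=\Lambda^\#$ and $\sigma^2=-\mathrm{Id}$. Let $\mathfrak{P}$ be a prime ideal of $\mathcal{O}_K$ lying over a prime number that does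 not divide $m$, let $F=\mathcal{O}_K/\mathfrak{P}$ and $q=|F|$. Put $\alpha=(q|d_K|)^{1/(2\varphi(m))}$ and $$\Lambda_0=\alpha^{-1}\mathcal{O}_K\times\alpha\,\mathfrak{P}^{-1}\mathcal{O}_K^\#\subset E_m ,$$ where $\mathcal{O}_K^\#$ is the dual of $\mathcal{O}_K$ for the trace form, and let $\pi:\Lambda_0\to\Lambda_0/\mathfrak{P}\Lambda_0$ be the canonical surjection onto this $F$-vector space. Let $\mathcal{L}_{\mathcal C}(m,\mathfrak{P})$ be the family of all $\Lambda_C=\pi^{-1}(C)$, where $C$ runs through the one-dimensional $F$-subspaces of $\Lambda_0/\mathfrak{P}\Lambda_0$. **Corollary.** There are choices, for every $m\ge1$, of a prime ideal $\mathfrak{P}_m$ of the ring of integers of $\mathbb{Q}(\zeta_m)$ lying over a prime number that does not divide $m$, such that the cardinalities $q_m$ of the residue fields satisfy $\varphi(m)^2m=o\big(q_m^{1/\varphi(m)}\big)$ as $m\to\infty$. For every such choice there are infinitely many dimensions $n$ for which there is $m\ge 1$ with $n=2\varphi(m)=\dim E_m$ such that the family $\mathcal{L}_{\mathcal C}(m,\mathfrak{P}_m)$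 contains a symplectic lattice $\Lambda$ with $$\Delta(\Lambda)\ \ge\ \frac{0.89\,n\log\log n}{2^n}.$$ -/

import Mathlib

open scoped NumberField Pointwise

/-! ### Lattices in Euclidean spaces -/

section Lattices

variable {E : Type*} [NormedAddCommGroup E] [InnerProductSpace ℝ E] [FiniteDimensional ℝ E]

/-- A lattice: a discrete subgroup of `E` spanning `E` over `ℝ`. -/
def IsEuclideanLattice (L : Submodule ℤ E) : Prop :=
  DiscreteTopology L ∧ Submodule.span ℝ (L : Set E) = ⊤

/-- The dual lattice `L^# = {x | ∀ y ∈ L, ⟨x, y⟩ ∈ ℤ}`. -/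
def dualLattice (L : Submodule ℤ E) : Submodule ℤ E where
  carrier := {x | ∀ y ∈ L, ∃ k : ℤ, inner ℝ x y = (k : ℝ)}
  zero_mem' := fun y _ => ⟨0, by simp⟩
  add_mem' := by
    intro a b ha hb y hy
    obtain ⟨k, hk⟩ := ha y hy
    obtain ⟨l, hl⟩ := hb y hy
    exact ⟨k + l, by rw [inner_add_left, hk, hl]; push_cast; rfl⟩
  smul_mem' := by
    intro c a ha y hy
    obtain ⟨k, hk⟩ := ha y hy
    refine ⟨c * k, ?_⟩
    rw [← Int.cast_smul_eq_zsmul ℝ c a, real_inner_smul_left, hk]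
    push_cast
    rfl

/-- A symplectic lattice: there is an isometry `σ` of `E` with `σ(L) = L^#` and `σ² = -Id`. -/
def IsSymplecticLattice (L : Submodule ℤ E) : Prop :=
  IsEuclideanLattice L ∧
    ∃ σ : E ≃ₗᵢ[ℝ] E, σ '' (L : Set E) = (dualLattice L : Set E) ∧ ∀ x, σ (σ x) = -x

/-- The minimum `μ` of a lattice: the least norm of a nonzero vector. -/
noncomputable def latticeMinimum (L : Submodule ℤ E) : ℝ :=
  sInf {r : ℝ | ∃ x ∈ L, x ≠ 0 ∧ ‖x‖ = r}

/-- The packing density `Δ(L) = Vol(B(μ)) / (2^n Vol(L))`, where `n = dim E`. -/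
noncomputable def packingDensity [MeasurableSpace E] [BorelSpace E] (L : Submodule ℤ E) : ℝ :=
  MeasureTheory.volume.real (Metric.closedBall (0 : E) (latticeMinimum L)) /
    (2 ^ Module.finrank ℝ E * ZLattice.covolume L)

end Lattices

/-! ### The Euclidean space `K_ℝ` and the plane `K_ℝ²` -/

section Minkowski

variable (K : Type*) [Field K] [NumberField K]

/-- The real subspace of `∏_φ ℂ`, where `φ` runs through the embeddings `K → ℂ`, of the families
`(x_φ)` satisfying `x_{conj φ} = conj x_φ`. -/
noncomputable def minkowskiSubspace : Submodule ℝ (PiLp 2 (fun _ : K →+* ℂ => ℂ)) where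
  carrier := {x | ∀ φ : K →+* ℂ,
    x (NumberField.ComplexEmbedding.conjugate φ) = starRingEnd ℂ (x φ)}
  zero_mem' := fun φ => by simp
  add_mem' := by
    intro a b ha hb φ
    simp [ha φ, hb φ]
  smul_mem' := by
    intro c a ha φ
    simp [ha φ]

/-- The Euclidean space `K_ℝ = K ⊗ ℝ`, realized as the space of families `(x_φ)` of complex
numbers indexed by the embeddings `φ : K → ℂ` and satisfying `x_{conj φ} = conj x_φ`. Its scalar
product is `∑_φ x_φ * conj y_φ`, that is, the trace form `Tr(x ȳ)`. -/
def MinkowskiSpace : Type _ := minkowskiSubspace K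

noncomputable instance : NormedAddCommGroup (MinkowskiSpace K) :=
  inferInstanceAs (NormedAddCommGroup (minkowskiSubspace K))

noncomputable instance : InnerProductSpace ℝ (MinkowskiSpace K) :=
  inferInstanceAs (InnerProductSpace ℝ (minkowskiSubspace K))

instance : FiniteDimensional ℝ (MinkowskiSpace K) :=
  inferInstanceAs (FiniteDimensional ℝ (minkowskiSubspace K))

noncomputable instance : MeasurableSpace (MinkowskiSpace K) := borel _

instance : BorelSpace (MinkowskiSpace K) := ⟨rfl⟩

variable {K} in
/-- The coordinate `x_φ` of an element of `K_ℝ`. -/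
def MinkowskiSpace.coord (x : MinkowskiSpace K) (φ : K →+* ℂ) : ℂ := x.1 φ

@[ext]
theorem MinkowskiSpace.ext {K : Type*} [Field K] {x y : MinkowskiSpace K}
    (h : ∀ φ, x.coord φ = y.coord φ) : x = y :=
  Subtype.ext (PiLp.ext h)

theorem MinkowskiSpace.inner_eq (x y : MinkowskiSpace K) :
    ((inner ℝ x y : ℝ) : ℂ) = ∑ φ, x.coord φ * starRingEnd ℂ (y.coord φ) := by
  have h1 : (inner ℝ x y : ℝ) = ∑ φ : K →+* ℂ, inner ℝ (x.coord φ) (y.coord φ) := by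
    change (inner ℝ x.1 y.1 : ℝ) = _
    rw [PiLp.inner_apply]
    rfl
  have h2 : (inner ℝ x y : ℝ) = (∑ φ, x.coord φ * starRingEnd ℂ (y.coord φ)).re := by
    rw [h1, Complex.re_sum]
    refine Finset.sum_congr rfl fun φ _ => ?_
    simp only [Complex.inner, Complex.mul_re, Complex.conj_re, Complex.conj_im]
    ring
  rw [h2]
  refine Complex.conj_eq_iff_re.mp ?_
  rw [map_sum,
    ← Equiv.sum_comp (NumberField.ComplexEmbedding.involutive_conjugate K).toPerm]
  refine Finset.sum_congr rfl fun φ _ => ?_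
  have hx := x.2 φ
  have hy := y.2 φ
  change x.coord _ = _ at hx
  change y.coord _ = _ at hy
  simp only [Function.Involutive.coe_toPerm, map_mul, hx, hy, Complex.conj_conj]
  rfl

/-- Multiplication by algebraic integers on `K_ℝ`. -/
noncomputable instance : Module (𝓞 K) (MinkowskiSpace K) where
  smul a x := ⟨WithLp.toLp 2 (fun φ => φ (a : K) * x.1 φ), fun φ => by
    simp [x.2 φ]⟩
  one_smul x := by
    ext φ
    change φ ((1 : 𝓞 K) : K) * x.1 φ = x.1 φ
    simp
  mul_smul a b x := by
    ext φ
    change φ ((a * b : 𝓞 K) : K) * x.1 φ = φ (a : K) * (φ (b : K) * x.1 φ)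
    simp [mul_assoc]
  smul_zero a := by
    ext φ
    change φ (a : K) * (0 : ℂ) = 0
    simp
  smul_add a x y := by
    ext φ
    change φ (a : K) * (x.1 φ + y.1 φ) = φ (a : K) * x.1 φ + φ (a : K) * y.1 φ
    ring
  add_smul a b x := by
    ext φ
    change φ ((a + b : 𝓞 K) : K) * x.1 φ = φ (a : K) * x.1 φ + φ (b : K) * x.1 φ
    simp [add_mul]
  zero_smul x := by
    ext φ
    change φ ((0 : 𝓞 K) : K) * x.1 φ = 0
    simp

instance : SMulCommClass ℝ (𝓞 K) (MinkowskiSpace K) where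
  smul_comm r a x := by
    ext φ
    change (r : ℝ) • (φ (a : K) * x.1 φ) = φ (a : K) * (r • x.1 φ)
    exact (mul_smul_comm r _ _).symm

/-- The natural embedding `K → K_ℝ`, `x ↦ (φ(x))_φ`. -/
noncomputable def toMinkowski : K →ₗ[𝓞 K] MinkowskiSpace K where
  toFun x := ⟨WithLp.toLp 2 (fun φ => φ x), fun φ => by simp⟩
  map_add' x y := by
    ext φ
    change φ (x + y) = φ x + φ y
    simp
  map_smul' a x := by
    ext φ
    change φ (a • x) = φ (a : K) * φ x
    rw [Algebra.smul_def, map_mul]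

/-- The image in `K_ℝ` of a fractional ideal of `K`. -/
noncomputable def idealLattice (I : FractionalIdeal (nonZeroDivisors (𝓞 K)) K) :
    Submodule (𝓞 K) (MinkowskiSpace K) :=
  (I : Submodule (𝓞 K) K).map (toMinkowski K)

/-- The scalar product of `K_ℝ` is the trace form `Tr(x ȳ)`. -/
theorem inner_toMinkowski (c : K ≃ₐ[ℚ] K) (hc : ∀ (φ : K →+* ℂ) x, φ (c x) = starRingEnd ℂ (φ x))
    (x y : K) :
    inner ℝ (toMinkowski K x) (toMinkowski K y) = ((Algebra.trace ℚ K (x * c y) : ℚ) : ℝ) := by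
  have h1 := MinkowskiSpace.inner_eq K (toMinkowski K x) (toMinkowski K y)
  have h2 := trace_eq_sum_embeddings (K := ℚ) (L := K) ℂ (x := x * c y)
  rw [← (RingHom.equivRatAlgHom K ℂ).sum_comp] at h2
  have h3 : ((inner ℝ (toMinkowski K x) (toMinkowski K y) : ℝ) : ℂ) =
      (((Algebra.trace ℚ K (x * c y) : ℚ) : ℝ) : ℂ) := by
    rw [h1]
    rw [eq_ratCast] at h2
    rw [Complex.ofReal_ratCast]
    refine Eq.trans ?_ h2.symm
    refine Finset.sum_congr rfl fun φ _ => ?_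
    change φ x * starRingEnd ℂ (φ y) = φ (x * c y)
    rw [map_mul, hc]
  exact_mod_cast h3

/-- Complex conjugation on an abelian number field. -/
theorem exists_conj_of_isAbelianGalois [IsAbelianGalois ℚ K] :
    ∃ c : K ≃ₐ[ℚ] K, ∀ (φ : K →+* ℂ) x, φ (c x) = starRingEnd ℂ (φ x) := by
  let φ₀ : K →+* ℂ := Classical.choice inferInstance
  obtain ⟨σ, hσ⟩ := NumberField.ComplexEmbedding.exists_comp_symm_eq_of_comp_eq (k := ℚ) φ₀
    (NumberField.ComplexEmbedding.conjugate φ₀) (by ext; simp)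
  refine ⟨σ.symm, fun φ x => ?_⟩
  obtain ⟨ν, rfl⟩ := NumberField.ComplexEmbedding.exists_comp_symm_eq_of_comp_eq (k := ℚ) φ₀ φ
    (by ext; simp)
  have h1 : ν.symm (σ.symm x) = σ.symm (ν.symm x) :=
    DFunLike.congr_fun (mul_comm' (ν.symm : Gal(K/ℚ)) σ.symm) x
  have h2 := RingHom.congr_fun hσ (ν.symm x)
  change φ₀ (ν.symm (σ.symm x)) = starRingEnd ℂ (φ₀ (ν.symm x))
  rw [h1]
  exact h2

/-- For an abelian number field, the dual lattice of `𝓞_K` in `K_ℝ` is the image of the fractional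
ideal of all `x ∈ K` with `Tr(x y) ∈ ℤ` for every `y ∈ 𝓞_K`. -/
theorem dualLattice_idealLattice_one [IsAbelianGalois ℚ K] :
    (dualLattice ((idealLattice K 1).restrictScalars ℤ) : Set (MinkowskiSpace K)) =
      idealLattice K (FractionalIdeal.dual ℤ ℚ 1) := by
  obtain ⟨c, hc⟩ := exists_conj_of_isAbelianGalois K
  have hint : ∀ x : K, toMinkowski K x ∈ dualLattice ((idealLattice K 1).restrictScalars ℤ) ↔
      x ∈ (FractionalIdeal.dual ℤ ℚ 1 : FractionalIdeal (nonZeroDivisors (𝓞 K)) K) := by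
    intro x
    rw [FractionalIdeal.mem_dual
      (one_ne_zero : (1 : FractionalIdeal (nonZeroDivisors (𝓞 K)) K) ≠ 0)]
    constructor
    · intro h a ha
      obtain ⟨a, rfl⟩ := (FractionalIdeal.mem_one_iff _).mp ha
      obtain ⟨k, hk⟩ := h (toMinkowski K (c.symm a)) ⟨_, (FractionalIdeal.mem_one_iff _).mpr
        ⟨⟨c.symm a, a.2.map c.symm⟩, rfl⟩, rfl⟩
      rw [inner_toMinkowski K c hc, AlgEquiv.apply_symm_apply] at hk
      exact ⟨k, by rw [Algebra.traceForm_apply]; exact_mod_cast hk.symm⟩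
    · rintro h _ ⟨a, ha, rfl⟩
      obtain ⟨a, rfl⟩ := (FractionalIdeal.mem_one_iff _).mp ha
      obtain ⟨k, hk⟩ := h (c a) ((FractionalIdeal.mem_one_iff _).mpr ⟨⟨c a, a.2.map c⟩, rfl⟩)
      refine ⟨k, ?_⟩
      rw [inner_toMinkowski K c hc]
      rw [Algebra.traceForm_apply] at hk
      exact_mod_cast hk.symm
  ext v
  constructor
  · intro hv
    choose n hn using fun i => hv (toMinkowski K (NumberField.integralBasis K i))
      ⟨_, (FractionalIdeal.mem_one_iff _).mpr ⟨NumberField.RingOfIntegers.basis K i,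
        (NumberField.integralBasis_apply K i).symm⟩, rfl⟩
    let ℓ : K →ₗ[ℚ] ℚ := (NumberField.integralBasis K).constr ℚ fun i => (n i : ℚ)
    let y₀ : K := ((Algebra.traceForm ℚ K).toDual (traceForm_nondegenerate ℚ K)).symm ℓ
    have hy₀ : ∀ x, Algebra.trace ℚ K (y₀ * x) = ℓ x := fun x => by
      rw [← Algebra.traceForm_apply]
      exact LinearMap.BilinForm.apply_toDual_symm_apply (hB := traceForm_nondegenerate ℚ K) ℓ x
    let f : K →ₗ[ℚ] ℝ := ((innerₛₗ ℝ (v - toMinkowski K (c y₀))).toAddMonoidHom.comp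
      (toMinkowski K).toAddMonoidHom).toRatLinearMap
    have hf : f = 0 := (NumberField.integralBasis K).ext fun i => by
      change inner ℝ (v - toMinkowski K (c y₀)) (toMinkowski K _) = (0 : ℝ)
      rw [inner_sub_left, hn, inner_toMinkowski K c hc, ← map_mul, Algebra.trace_eq_of_algEquiv,
        hy₀, Module.Basis.constr_basis]
      simp
    have hu : v = toMinkowski K (c y₀) := by
      have hinj : Function.Injective fun φ : K →+* ℂ =>
          ((NumberField.ComplexEmbedding.conjugate φ : K →+* ℂ) : K →* ℂ) := fun φ ψ h =>
        (NumberField.ComplexEmbedding.involutive_conjugate K).injective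
          (RingHom.ext fun x => DFunLike.congr_fun h x)
      have hli := Fintype.linearIndependent_iff.mp
        ((linearIndependent_monoidHom K ℂ).comp _ hinj)
        (fun φ => (v - toMinkowski K (c y₀)).coord φ) (by
          ext x
          have h1 := MinkowskiSpace.inner_eq K (v - toMinkowski K (c y₀)) (toMinkowski K x)
          have h2 : inner ℝ (v - toMinkowski K (c y₀)) (toMinkowski K x) = (0 : ℝ) :=
            LinearMap.congr_fun hf x
          rw [h2] at h1
          rw [Finset.sum_apply]
          exact h1.symm)
      refine sub_eq_zero.mp (MinkowskiSpace.ext hli)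
    exact ⟨c y₀, (hint _).mp (hu ▸ hv), hu.symm⟩
  · rintro ⟨x, hx, rfl⟩
    exact (hint x).mpr hx

/-- The Euclidean space `K_ℝ²`, with scalar product `⟨x₁, y₁⟩ + ⟨x₂, y₂⟩`. -/
abbrev MinkowskiPlane : Type _ := WithLp 2 (MinkowskiSpace K × MinkowskiSpace K)

end Minkowski

/-! ### The lattices constructed from lines over the residue field -/

section Codes

variable {K : Type*} [Field K] [NumberField K]

/-- `α = (q |d_K|)^(1 / (2 [K : ℚ]))`, where `q` is the cardinality of `𝓞 K ⧸ P` and `d_K` is the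
discriminant of `K`. -/
noncomputable def scalingFactor (P : Ideal (𝓞 K)) : ℝ :=
  ((Nat.card (𝓞 K ⧸ P) : ℝ) * |(NumberField.discr K : ℝ)|) ^
    (1 / (2 * (Module.finrank ℚ K : ℝ)))

/-- `Λ₀ = α⁻¹ 𝓞_K × α P⁻¹ 𝓞_K^#`, an `𝓞_K`-submodule of `K_ℝ²`. Here `𝓞_K^#` is the fractional
ideal of all `x ∈ K` with `Tr(x y) ∈ ℤ` for every `y ∈ 𝓞_K`. -/
noncomputable def baseLattice (P : Ideal (𝓞 K)) : Submodule (𝓞 K) (MinkowskiPlane K) :=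
  ((((scalingFactor P)⁻¹ • idealLattice K 1 : Submodule (𝓞 K) (MinkowskiSpace K))).prod
    (scalingFactor P • idealLattice K
      ((P : FractionalIdeal (nonZeroDivisors (𝓞 K)) K)⁻¹ *
        FractionalIdeal.dual ℤ ℚ 1))).comap
    (WithLp.linearEquiv 2 (𝓞 K) (MinkowskiSpace K × MinkowskiSpace K)).toLinearMap

/-- The quotient `Λ₀ / P Λ₀`, a vector space over the residue field `𝓞 K ⧸ P`. -/
abbrev CodeSpace (P : Ideal (𝓞 K)) : Type _ :=
  baseLattice P ⧸ (P • ⊤ : Submodule (𝓞 K) (baseLattice P))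

/-- `Λ_C`, the preimage in `Λ₀` of a subspace `C` of `Λ₀ / P Λ₀`, as a subgroup of `K_ℝ²`. -/
noncomputable def codeLattice (P : Ideal (𝓞 K)) (C : Submodule (𝓞 K ⧸ P) (CodeSpace P)) :
    Submodule ℤ (MinkowskiPlane K) :=
  AddSubgroup.toIntSubmodule
    ((C.toAddSubgroup.comap
      (Submodule.mkQ (P • ⊤ : Submodule (𝓞 K) (baseLattice P))).toAddMonoidHom).map
        (baseLattice P).subtype.toAddMonoidHom)

/-- The family of the lattices `Λ_C`, where `C` runs through the lines of `Λ₀ / P Λ₀`. -/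
def codeLatticeFamily (P : Ideal (𝓞 K)) : Set (Submodule ℤ (MinkowskiPlane K)) :=
  {L | ∃ C : Submodule (𝓞 K ⧸ P) (CodeSpace P),
    Module.finrank (𝓞 K ⧸ P) C = 1 ∧ L = codeLattice P C}

end Codes

/-- A choice, for every `m ≥ 1`, of a prime ideal `P m` of the ring of integers of `ℚ(ζ_m)`, lying
over a prime number that does not divide `m`, such that the cardinalities `q_m` of the residue
fields satisfy `φ(m)² m = o(q_m^(1/φ(m)))` as `m → ∞`. -/
def IsAdmissiblePrimeChoice (P : (m : ℕ+) → Ideal (𝓞 (CyclotomicField (m : ℕ) ℚ))) : Prop :=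
  (∀ m : ℕ+, (P m).IsPrime ∧ ∃ p : ℕ, p.Prime ∧ ¬ p ∣ (m : ℕ) ∧
    (P m).LiesOver (Ideal.span {(p : ℤ)})) ∧
  (fun m : ℕ+ => ((m : ℕ).totient : ℝ) ^ 2 * ((m : ℕ) : ℝ)) =o[Filter.atTop]
    (fun m : ℕ+ => (Nat.card (𝓞 (CyclotomicField (m : ℕ) ℚ) ⧸ P m) : ℝ) ^
      (1 / ((m : ℕ).totient : ℝ)))

/-!
The isometry `(x, y) ↦ (-ȳ, x̄)` of `E_m` turns the scalar product into the trace of the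
determinant, and the determinant of two vectors of `Λ_C` lies in `𝓞_K^#` because a line is
isotropic for an alternating form. This isometry therefore carries `Λ_C` onto its dual: every
`Λ_C` is symplectic, and so has covolume `1`.

Suppose that every `Λ_C` had a nonzero vector shorter than `r`. Multiplying it by the powers of
`ζ_m` gives `m` such vectors in `Λ_C`. Two lines share only vectors of `𝔓Λ₀`, which are long by
the inequality of arithmetic and geometric means since their norms are divisible by `𝔓`. There are
`q + 1` lines, so the ball of radius `r` contains more than `m q` points of `Λ₀`, a lattice of
covolume `1 / q` and of small covering radius, and its volume is at least about `m`. Hence some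
`Λ_C` has density about `m / 2 ^ n`, and it remains to find `m` with `m / φ(m)` close to
`e^γ log log φ(m)`.

The primorials achieve this, by a weak form of Mertens' third theorem. If
`∑_{p ≤ x} -log (1 - 1/p)` were at most `log log x + γ - η` for all large `x`, then it would be at
most `h - η / 2`, where `h` is the harmonic number of index `⌈log x⌉ - 1`. Integrating against
`δ x^{-1-δ}` turns the left side into `log ζ(1 + δ) = -log δ + o(1)` as `δ → 0`, up to `o(1)`, and
`h` into `-log (1 - e^{-δ}) = -log δ + o(1)`, so `η > 0` is impossible.
-/

/-! ### Mertens' third theorem along a subsequence -/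

section ExponentialLaw

open MeasureTheory ProbabilityTheory

variable {δ : ℝ}

theorem measureReal_expMeasure_Iic (hδ : 0 < δ) {x : ℝ} (hx : 0 ≤ x) :
    (expMeasure δ).real (Set.Iic x) = 1 - Real.exp (-(δ * x)) := by
  have := isProbabilityMeasure_expMeasure hδ
  rw [← cdf_eq_real, cdf_expMeasure_eq hδ, if_pos hx]

theorem measureReal_expMeasure_Ioi (hδ : 0 < δ) {x : ℝ} (hx : 0 ≤ x) :
    (expMeasure δ).real (Set.Ioi x) = Real.exp (-(δ * x)) := by
  have := isProbabilityMeasure_expMeasure hδ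
  rw [← Set.compl_Iic, probReal_compl_eq_one_sub measurableSet_Iic,
    measureReal_expMeasure_Iic hδ hx, sub_sub_cancel]

theorem ae_expMeasure_pos (hδ : 0 < δ) : ∀ᵐ u ∂expMeasure δ, 0 < u := by
  have := isProbabilityMeasure_expMeasure hδ
  have hIic : expMeasure δ (Set.Iic 0) = 0 := by
    rw [← measureReal_eq_zero_iff, measureReal_expMeasure_Iic hδ le_rfl]
    simp
  simpa only [ae_iff, not_lt] using! hIic

theorem integrable_indicator_const_expMeasure (hδ : 0 < δ) {s : Set ℝ} (hs : MeasurableSet s)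
    (c : ℝ) : Integrable (s.indicator fun _ => c) (expMeasure δ) :=
  have := isProbabilityMeasure_expMeasure hδ
  (integrable_const c).indicator hs

theorem integral_indicator_Ioi_expMeasure (hδ : 0 < δ) {x : ℝ} (hx : 0 ≤ x) (c : ℝ) :
    ∫ u, (Set.Ioi x).indicator (fun _ => c) u ∂expMeasure δ = c * Real.exp (-(δ * x)) := by
  rw [integral_indicator_const c measurableSet_Ioi, measureReal_expMeasure_Ioi hδ hx, smul_eq_mul,
    mul_comm]

theorem sum_filter_lt_eq_sum_indicator {ι : Type*} (s : Finset ι) (a x : ι → ℝ) (u : ℝ) :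
    ∑ i ∈ s with x i < u, a i = ∑ i ∈ s, (Set.Ioi (x i)).indicator (fun _ => a i) u := by
  simp only [Finset.sum_filter, Set.indicator, Set.mem_Ioi]

theorem integrable_sum_filter_lt_expMeasure {ι : Type*} (s : Finset ι) (a x : ι → ℝ)
    (hδ : 0 < δ) : Integrable (fun u => ∑ i ∈ s with x i < u, a i) (expMeasure δ) := by
  simp only [sum_filter_lt_eq_sum_indicator]
  exact integrable_finsetSum _ fun i _ =>
    integrable_indicator_const_expMeasure hδ measurableSet_Ioi (a i)

theorem integral_sum_filter_lt_expMeasure {ι : Type*} (s : Finset ι) (a : ι → ℝ) {x : ι → ℝ}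
    (hx : ∀ i ∈ s, 0 ≤ x i) (hδ : 0 < δ) :
    ∫ u, ∑ i ∈ s with x i < u, a i ∂expMeasure δ = ∑ i ∈ s, a i * Real.exp (-(δ * x i)) := by
  simp only [sum_filter_lt_eq_sum_indicator]
  rw [integral_finsetSum _ fun i _ =>
    integrable_indicator_const_expMeasure hδ measurableSet_Ioi (a i)]
  exact Finset.sum_congr rfl fun i hi => integral_indicator_Ioi_expMeasure hδ (hx i hi) (a i)

theorem harmonic_ceil_sub_one_eq_tsum (u : ℝ) : (harmonic (⌈u⌉₊ - 1) : ℝ) =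
    ∑' k : ℕ, (Set.Ioi ((k : ℝ) + 1)).indicator (fun _ => 1 / ((k : ℝ) + 1)) u := by
  have hlt : ∀ k : ℕ, k < ⌈u⌉₊ - 1 ↔ (k : ℝ) + 1 < u := fun k => by
    rw [Nat.lt_sub_iff_add_lt, Nat.lt_ceil, Nat.cast_add_one]
  have hzero : ∀ k ∉ Finset.range (⌈u⌉₊ - 1),
      (Set.Ioi ((k : ℝ) + 1)).indicator (fun _ => 1 / ((k : ℝ) + 1)) u = 0 := fun k hk =>
    Set.indicator_of_notMem (fun h => hk (Finset.mem_range.mpr ((hlt k).mpr h))) _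
  rw [tsum_eq_sum hzero, harmonic, Rat.cast_sum]
  refine Finset.sum_congr rfl fun k hk => ?_
  rw [Set.indicator_of_mem (Set.mem_Ioi.mpr ((hlt k).mp (Finset.mem_range.mp hk)))]
  push_cast
  rw [one_div]

theorem hasSum_exp_neg_mul_div (hδ : 0 < δ) :
    HasSum (fun k : ℕ => 1 / ((k : ℝ) + 1) * Real.exp (-(δ * ((k : ℝ) + 1))))
      (-Real.log (1 - Real.exp (-δ))) := by
  have hlt : |Real.exp (-δ)| < 1 := by
    rw [Real.abs_exp]
    exact Real.exp_lt_one_iff.mpr (neg_lt_zero.mpr hδ)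
  convert Real.hasSum_pow_div_log_of_abs_lt_one hlt using 2 with k
  rw [← Real.exp_nat_mul, one_div_mul_eq_div]
  push_cast
  ring_nf

theorem integral_harmonic_ceil_expMeasure (hδ : 0 < δ) :
    ∫ u, (harmonic (⌈u⌉₊ - 1) : ℝ) ∂expMeasure δ = -Real.log (1 - Real.exp (-δ)) := by
  have hterm : ∀ k : ℕ, ∫ u, (Set.Ioi ((k : ℝ) + 1)).indicator (fun _ => 1 / ((k : ℝ) + 1)) u
      ∂expMeasure δ = 1 / ((k : ℝ) + 1) * Real.exp (-(δ * ((k : ℝ) + 1))) := fun k =>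
    integral_indicator_Ioi_expMeasure hδ (by positivity) _
  have hnorm : ∀ (k : ℕ) (u : ℝ),
      ‖(Set.Ioi ((k : ℝ) + 1)).indicator (fun _ => 1 / ((k : ℝ) + 1)) u‖ =
        (Set.Ioi ((k : ℝ) + 1)).indicator (fun _ => 1 / ((k : ℝ) + 1)) u := fun k u =>
    Real.norm_of_nonneg (Set.indicator_nonneg (fun _ _ => by positivity) u)
  simp only [harmonic_ceil_sub_one_eq_tsum]
  have hsum := hasSum_integral_of_summable_integral_norm
    (fun k : ℕ => integrable_indicator_const_expMeasure hδ
      (measurableSet_Ioi (a := (k : ℝ) + 1)) (1 / ((k : ℝ) + 1)))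
    (by simpa only [hnorm, hterm] using (hasSum_exp_neg_mul_div hδ).summable)
  simp only [hterm] at hsum
  exact hsum.unique (hasSum_exp_neg_mul_div hδ)

theorem integrable_harmonic_ceil_expMeasure (hδ : 0 < δ) :
    Integrable (fun u : ℝ => (harmonic (⌈u⌉₊ - 1) : ℝ)) (expMeasure δ) := by
  refine Integrable.of_integral_ne_zero ?_
  have hpos : 0 < 1 - Real.exp (-δ) := sub_pos.mpr (Real.exp_lt_one_iff.mpr (neg_lt_zero.mpr hδ))
  rw [integral_harmonic_ceil_expMeasure hδ]
  exact (neg_pos.mpr (Real.log_neg hpos (sub_lt_self _ (Real.exp_pos _)))).ne'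

theorem sum_mul_exp_le_of_sum_filter_lt_le {ι : Type*} {s : Finset ι} {a x : ι → ℝ}
    (hx : ∀ i ∈ s, 0 ≤ x i) {C η w : ℝ} (hw : 0 ≤ w) (hδ : 0 < δ)
    (h : ∀ u, 0 < u → ∑ i ∈ s with x i < u, a i + η ≤
      harmonic (⌈u⌉₊ - 1) + (Set.Iic w).indicator (fun _ => C) u) :
    ∑ i ∈ s, a i * Real.exp (-(δ * x i)) + η ≤
      -Real.log (1 - Real.exp (-δ)) + C * (1 - Real.exp (-(δ * w))) := by
  have := isProbabilityMeasure_expMeasure hδ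
  have hL := integrable_sum_filter_lt_expMeasure s a x hδ
  have hR := integrable_harmonic_ceil_expMeasure hδ
  have hw_int := integrable_indicator_const_expMeasure hδ (measurableSet_Iic (a := w)) C
  have hmono := integral_mono_ae (hL.add (integrable_const η)) (hR.add hw_int)
    ((ae_expMeasure_pos hδ).mono h)
  simp only [Pi.add_apply] at hmono
  rwa [integral_add hL (integrable_const η), integral_add hR hw_int, integral_const,
    probReal_univ, one_smul, integral_sum_filter_lt_expMeasure s a hx hδ,
    integral_harmonic_ceil_expMeasure hδ, integral_indicator_const C measurableSet_Iic,
    measureReal_expMeasure_Iic hδ hw, smul_eq_mul, mul_comm _ C] at hmono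

end ExponentialLaw

section Mertens

open Filter Topology

theorem one_sub_inv_natCast_pos {p : ℕ} (hp : 1 < p) : (0 : ℝ) < 1 - (p : ℝ)⁻¹ :=
  sub_pos.mpr (inv_lt_one_of_one_lt₀ (Nat.one_lt_cast.mpr hp))

theorem neg_log_one_sub_inv_natCast_nonneg (p : ℕ) : 0 ≤ -Real.log (1 - (p : ℝ)⁻¹) :=
  neg_nonneg.mpr <| Real.log_nonpos (sub_nonneg.mpr p.cast_inv_le_one)
    (sub_le_self 1 (by positivity))

/-- The logarithm of the Mertens product `∏_{p ≤ n} (1 - 1 / p)⁻¹`. -/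
noncomputable def logMertensProduct (n : ℕ) : ℝ :=
  ∑ p ∈ n.primesLE, -Real.log (1 - (p : ℝ)⁻¹)

theorem logMertensProduct_mono : Monotone logMertensProduct := fun _ _ h =>
  Finset.sum_le_sum_of_subset_of_nonneg (Nat.primesLE_mono h)
    fun p _ _ => neg_log_one_sub_inv_natCast_nonneg p

theorem totient_primorial_mul_exp_logMertensProduct (n : ℕ) :
    ((primorial n).totient : ℝ) * Real.exp (logMertensProduct n) = primorial n := by
  have htotient := congrArg (Rat.cast : ℚ → ℝ) (Nat.totient_eq_mul_prod_factors (primorial n))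
  rw [primeFactors_primorial] at htotient
  push_cast at htotient
  rw [htotient, logMertensProduct, Real.exp_sum, mul_assoc, ← Finset.prod_mul_distrib]
  refine mul_eq_left₀ (by exact_mod_cast primorial_ne_zero n) |>.mpr <|
    Finset.prod_eq_one fun p hp => ?_
  have hpos := one_sub_inv_natCast_pos (Nat.one_lt_of_mem_primesLE hp)
  rw [Real.exp_neg, Real.exp_log hpos, mul_inv_cancel₀ hpos.ne']

theorem neg_log_one_sub_mul_le {x y : ℝ} (hx : x < 1) (hy0 : 0 ≤ y) (hy : y ≤ 1) :
    -Real.log (1 - x * y) ≤ -Real.log (1 - x) * y := by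
  have hconcave := strictConcaveOn_log_Ioi.concaveOn.2 (x := 1 - x) (y := 1) (sub_pos.mpr hx)
    (Set.mem_Ioi.mpr one_pos) hy0 (sub_nonneg.mpr hy) (add_sub_cancel y 1)
  simp only [smul_eq_mul, Real.log_one, mul_zero, add_zero, mul_one] at hconcave
  rw [show y * (1 - x) + (1 - y) = 1 - x * y by ring] at hconcave
  linarith

theorem rpow_neg_one_add_eq_inv_mul_exp {x : ℝ} (hx : 0 < x) (δ : ℝ) :
    x ^ (-(1 + δ)) = x⁻¹ * Real.exp (-(δ * Real.log x)) := by
  rw [neg_add, Real.rpow_add hx, Real.rpow_neg_one, Real.rpow_def_of_pos hx]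
  ring_nf

theorem neg_log_one_sub_rpow_le {p : ℕ} (hp : 1 < p) {δ : ℝ} (hδ : 0 ≤ δ) :
    -Real.log (1 - (p : ℝ) ^ (-(1 + δ))) ≤
      -Real.log (1 - (p : ℝ)⁻¹) * Real.exp (-(δ * Real.log p)) := by
  rw [rpow_neg_one_add_eq_inv_mul_exp (by positivity)]
  exact neg_log_one_sub_mul_le (sub_pos.mp (one_sub_inv_natCast_pos hp)) (Real.exp_pos _).le
    (Real.exp_le_one_iff.mpr (neg_nonpos.mpr (mul_nonneg hδ (Real.log_natCast_nonneg p))))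

theorem norm_riemannZeta_one_add_ne_zero {δ : ℝ} (hδ : 0 < δ) :
    ‖riemannZeta ((1 + δ : ℝ) : ℂ)‖ ≠ 0 :=
  norm_ne_zero_iff.mpr (riemannZeta_ne_zero_of_one_lt_re (by simpa using hδ))

theorem norm_eulerFactor {p : ℕ} (hp : 1 < p) {δ : ℝ} (hδ : 0 < δ) :
    ‖(1 - (p : ℂ) ^ (-((1 + δ : ℝ) : ℂ)))⁻¹‖ = (1 - (p : ℝ) ^ (-(1 + δ)))⁻¹ := by
  have hreal : (1 - (p : ℂ) ^ (-((1 + δ : ℝ) : ℂ))) = ((1 - (p : ℝ) ^ (-(1 + δ)) : ℝ) : ℂ) := by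
    rw [Complex.ofReal_sub, Complex.ofReal_one, Complex.ofReal_cpow (by positivity)]
    push_cast
    rfl
  have hlt : (p : ℝ) ^ (-(1 + δ)) < 1 :=
    Real.rpow_lt_one_of_one_lt_of_neg (Nat.one_lt_cast.mpr hp) (by linarith)
  rw [hreal, norm_inv, Complex.norm_real, Real.norm_of_nonneg (sub_nonneg.mpr hlt.le)]

theorem tendsto_sum_neg_log_eulerFactor {δ : ℝ} (hδ : 0 < δ) :
    Tendsto (fun n : ℕ => ∑ p ∈ n.primesBelow, -Real.log (1 - (p : ℝ) ^ (-(1 + δ)))) atTop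
      (𝓝 (Real.log ‖riemannZeta ((1 + δ : ℝ) : ℂ)‖)) := by
  have hlim := (riemannZeta_eulerProduct (s := ((1 + δ : ℝ) : ℂ)) (by simpa using hδ)).norm.log
    (norm_riemannZeta_one_add_ne_zero hδ)
  refine hlim.congr fun n => ?_
  have hfactor : ∀ p ∈ n.primesBelow,
      ‖(1 - (p : ℂ) ^ (-((1 + δ : ℝ) : ℂ)))⁻¹‖ = (1 - (p : ℝ) ^ (-(1 + δ)))⁻¹ := fun p hp =>
    norm_eulerFactor (Nat.prime_of_mem_primesBelow hp).one_lt hδ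
  have hne : ∀ p ∈ n.primesBelow, (1 - (p : ℝ) ^ (-(1 + δ)))⁻¹ ≠ 0 := fun p hp =>
    inv_ne_zero (sub_pos.mpr (Real.rpow_lt_one_of_one_lt_of_neg
      (Nat.one_lt_cast.mpr (Nat.prime_of_mem_primesBelow hp).one_lt) (by linarith))).ne'
  rw [norm_prod, Finset.prod_congr rfl hfactor, Real.log_prod hne]
  simp only [Real.log_inv]

theorem tendsto_one_sub_exp_neg_div :
    Tendsto (fun δ : ℝ => (1 - Real.exp (-δ)) / δ) (𝓝[>] 0) (𝓝 1) := by
  have hderiv : HasDerivAt (fun δ : ℝ => 1 - Real.exp (-δ)) 1 0 := by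
    simpa using ((hasDerivAt_neg (0 : ℝ)).exp).const_sub 1
  simpa [div_eq_inv_mul] using hderiv.tendsto_slope_zero_right

theorem tendsto_mul_norm_riemannZeta_one_add :
    Tendsto (fun δ : ℝ => δ * ‖riemannZeta ((1 + δ : ℝ) : ℂ)‖) (𝓝[>] 0) (𝓝 1) := by
  have hpole : Tendsto (fun δ : ℝ => ((1 + δ : ℝ) : ℂ)) (𝓝[>] 0) (𝓝[≠] 1) := by
    refine tendsto_nhdsWithin_iff.mpr ⟨?_, ?_⟩
    · have hcont : ContinuousAt (fun δ : ℝ => ((1 + δ : ℝ) : ℂ)) 0 := by fun_prop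
      simpa using hcont.tendsto.mono_left nhdsWithin_le_nhds
    · filter_upwards [self_mem_nhdsWithin] with δ hδ
      simpa using (Set.mem_Ioi.mp hδ).ne'
  have hres := (riemannZeta_residue_one.comp hpole).norm
  rw [norm_one] at hres
  refine hres.congr' ?_
  filter_upwards [self_mem_nhdsWithin] with δ hδ
  simp [abs_of_pos (Set.mem_Ioi.mp hδ)]

theorem tendsto_log_norm_riemannZeta_add_log :
    Tendsto (fun δ : ℝ => Real.log ‖riemannZeta ((1 + δ : ℝ) : ℂ)‖ +
      Real.log (1 - Real.exp (-δ))) (𝓝[>] 0) (𝓝 0) := by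
  have hprod := (tendsto_mul_norm_riemannZeta_one_add.mul tendsto_one_sub_exp_neg_div).log
    (by norm_num)
  rw [mul_one, Real.log_one] at hprod
  refine hprod.congr' ?_
  filter_upwards [self_mem_nhdsWithin] with δ (hδ : 0 < δ)
  have hexp : 1 - Real.exp (-δ) ≠ 0 :=
    (sub_pos.mpr (Real.exp_lt_one_iff.mpr (neg_lt_zero.mpr hδ))).ne'
  rw [← Real.log_mul (norm_riemannZeta_one_add_ne_zero hδ) hexp]
  congr 1
  field_simp

theorem log_norm_riemannZeta_add_le {C η w δ : ℝ} (hw : 0 ≤ w) (hδ : 0 < δ)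
    (h : ∀ u, 0 < u → logMertensProduct ⌊Real.exp u⌋₊ + η ≤
      harmonic (⌈u⌉₊ - 1) + (Set.Iic w).indicator (fun _ => C) u) :
    Real.log ‖riemannZeta ((1 + δ : ℝ) : ℂ)‖ + η ≤
      -Real.log (1 - Real.exp (-δ)) + C * (1 - Real.exp (-(δ * w))) := by
  refine le_of_tendsto ((tendsto_sum_neg_log_eulerFactor hδ).add_const η)
    (Eventually.of_forall fun n => ?_)
  have hpartial : ∀ u : ℝ, ∑ p ∈ n.primesBelow with Real.log (p : ℕ) < u,
      -Real.log (1 - (p : ℝ)⁻¹) ≤ logMertensProduct ⌊Real.exp u⌋₊ := fun u => by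
    refine Finset.sum_le_sum_of_subset_of_nonneg (fun p hp => ?_)
      fun p _ _ => neg_log_one_sub_inv_natCast_nonneg p
    obtain ⟨hpn, hpu⟩ := Finset.mem_filter.mp hp
    have hprime := Nat.prime_of_mem_primesBelow hpn
    exact Nat.mem_primesLE.mpr ⟨Nat.le_floor
      ((Real.log_lt_iff_lt_exp (Nat.cast_pos.mpr hprime.pos)).mp hpu).le, hprime⟩
  calc ∑ p ∈ n.primesBelow, -Real.log (1 - (p : ℝ) ^ (-(1 + δ))) + η
      ≤ ∑ p ∈ n.primesBelow, -Real.log (1 - (p : ℝ)⁻¹) * Real.exp (-(δ * Real.log p)) + η := by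
        gcongr with p hp
        exact neg_log_one_sub_rpow_le (Nat.prime_of_mem_primesBelow hp).one_lt hδ.le
    _ ≤ _ := sum_mul_exp_le_of_sum_filter_lt_le (fun p _ => Real.log_natCast_nonneg p) hw hδ
        fun u hu => (add_le_add_left (hpartial u) η).trans (h u hu)

theorem nonpos_of_logMertensProduct_add_le_harmonic {C η w : ℝ} (hw : 0 ≤ w)
    (h : ∀ u, 0 < u → logMertensProduct ⌊Real.exp u⌋₊ + η ≤
      harmonic (⌈u⌉₊ - 1) + (Set.Iic w).indicator (fun _ => C) u) : η ≤ 0 := by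
  have hcont : ContinuousAt (fun δ : ℝ => C * (1 - Real.exp (-(δ * w)))) 0 := by fun_prop
  have hright : Tendsto (fun δ : ℝ => C * (1 - Real.exp (-(δ * w)))) (𝓝[>] 0) (𝓝 0) := by
    simpa using hcont.tendsto.mono_left nhdsWithin_le_nhds
  have hleft := tendsto_log_norm_riemannZeta_add_log.add_const η
  rw [zero_add] at hleft
  refine le_of_tendsto_of_tendsto hleft hright ?_
  filter_upwards [self_mem_nhdsWithin] with δ (hδ : 0 < δ)
  linarith [log_norm_riemannZeta_add_le hw hδ h]

theorem eventually_log_add_le_harmonic_ceil {c : ℝ} (hc : c < Real.eulerMascheroniConstant) :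
    ∀ᶠ u : ℝ in atTop, Real.log u + c ≤ harmonic (⌈u⌉₊ - 1) := by
  have hceil := (tendsto_sub_atTop_nat 1).comp (tendsto_nat_ceil_atTop (α := ℝ))
  filter_upwards [hceil.eventually
    (Real.tendsto_harmonic_sub_log_add_one.eventually_const_lt hc), eventually_gt_atTop 0]
    with u hlt hu
  have hcast : ((⌈u⌉₊ - 1 : ℕ) : ℝ) + 1 = ⌈u⌉₊ := by
    exact_mod_cast Nat.sub_add_cancel (Nat.ceil_pos.mpr hu)
  simp only [Function.comp_apply, hcast] at hlt
  linarith [Real.log_le_log hu (Nat.le_ceil u)]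

theorem frequently_log_add_lt_logMertensProduct {b : ℝ} (hb : b < Real.eulerMascheroniConstant) :
    ∃ᶠ u : ℝ in atTop, Real.log u + b < logMertensProduct ⌊Real.exp u⌋₊ := by
  intro hcontra
  obtain ⟨c, hbc, hc⟩ := exists_between hb
  obtain ⟨w, hwpos, hw⟩ := ((eventually_ge_atTop (0 : ℝ)).and
    (eventually_forall_ge_atTop.mpr
      (hcontra.and (eventually_log_add_le_harmonic_ceil hc)))).exists
  refine (sub_pos.mpr hbc).not_ge <| nonpos_of_logMertensProduct_add_le_harmonic hwpos
    (C := logMertensProduct ⌊Real.exp w⌋₊ + (c - b)) fun u _ => ?_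
  have hharmonic : (0 : ℝ) ≤ harmonic (⌈u⌉₊ - 1) := by
    exact_mod_cast Finset.sum_nonneg fun i _ => by positivity
  rcases le_or_gt u w with huw | hwu
  · have hmono : logMertensProduct ⌊Real.exp u⌋₊ ≤ logMertensProduct ⌊Real.exp w⌋₊ :=
      logMertensProduct_mono (by gcongr)
    rw [Set.indicator_of_mem (Set.mem_Iic.mpr huw)]
    linarith
  · obtain ⟨hupper, hlower⟩ := hw u hwu.le
    rw [Set.indicator_of_notMem (Set.notMem_Iic.mpr hwu)]
    linarith

end Mertens

section EulerMascheroni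

open Filter Topology

/- The trapezoidal rule overestimates the integral of the convex function `1 / t`. Here this is
`t ≤ sinh t` at `t = log ((x + 1) / x)`. -/
theorem log_add_one_sub_log_le {x : ℝ} (hx : 0 < x) :
    Real.log (x + 1) - Real.log x ≤ 1 / (2 * x) + 1 / (2 * (x + 1)) := by
  have hlog : 0 ≤ Real.log ((x + 1) / x) := Real.log_nonneg (by rw [le_div_iff₀ hx]; linarith)
  have hsinh := Real.self_le_sinh_iff.mpr hlog
  rw [Real.sinh_eq, Real.exp_neg, Real.exp_log (by positivity),
    Real.log_div (by positivity) hx.ne'] at hsinh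
  refine hsinh.trans_eq ?_
  field_simp
  ring

theorem monotone_harmonic_sub_log_sub : Monotone fun n : ℕ =>
    (harmonic (n + 1) : ℝ) - Real.log (n + 1 : ℕ) - 1 / (2 * (n + 1 : ℕ)) := by
  refine monotone_nat_of_le_succ fun n => ?_
  have hstep := log_add_one_sub_log_le (x := (n : ℝ) + 1) (by positivity)
  rw [harmonic_succ (n + 1)]
  push_cast
  have hhalf : ((n : ℝ) + 1 + 1)⁻¹ = 2 * (1 / (2 * ((n : ℝ) + 1 + 1))) := by
    field_simp
  linarith

theorem harmonic_sub_log_sub_le_eulerMascheroniConstant (n : ℕ) :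
    (harmonic (n + 1) : ℝ) - Real.log (n + 1 : ℕ) - 1 / (2 * (n + 1 : ℕ)) ≤
      Real.eulerMascheroniConstant := by
  refine monotone_harmonic_sub_log_sub.ge_of_tendsto ?_ n
  have hcorrection : Tendsto (fun n : ℕ => 1 / (2 * (n : ℝ))) atTop (𝓝 0) := by
    simpa [one_div, mul_comm] using
      (tendsto_inv_atTop_nhds_zero_nat (𝕜 := ℝ)).mul_const (2⁻¹ : ℝ)
  have hlim := Real.tendsto_harmonic_sub_log.sub hcorrection
  rw [sub_zero] at hlim
  exact hlim.comp (tendsto_add_atTop_nat 1)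

theorem lt_eulerMascheroniConstant : (0.57688 : ℝ) < Real.eulerMascheroniConstant := by
  have hle := harmonic_sub_log_sub_le_eulerMascheroniConstant 15
  have hharmonic : harmonic (15 + 1) = 2436559 / 720720 := by
    norm_num [harmonic, Finset.sum_range_succ]
  have hlog : Real.log ((15 + 1 : ℕ) : ℝ) = 4 * Real.log 2 := by
    rw [show ((15 + 1 : ℕ) : ℝ) = 2 ^ 4 by norm_num, Real.log_pow]
    norm_num
  rw [hharmonic, hlog] at hle
  have hlog_two := Real.log_two_lt_d9
  norm_num at hle ⊢
  linarith

theorem lt_exp_eulerMascheroniConstant : 1.78 < Real.exp Real.eulerMascheroniConstant := by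
  refine lt_of_le_of_lt ?_ (Real.exp_lt_exp.mpr lt_eulerMascheroniConstant)
  refine le_trans ?_ (Real.sum_le_exp_of_nonneg (by norm_num) 9)
  norm_num [Finset.sum_range_succ, Nat.factorial]

end EulerMascheroni

section Totient

open Filter

theorem tendsto_totient_primorial : Tendsto (fun n => (primorial n).totient) atTop atTop := by
  refine tendsto_atTop_atTop_of_monotone (fun a b hab => ?_) fun b => ?_
  · exact Nat.le_of_dvd (Nat.totient_pos.mpr (primorial_pos b))
      (Nat.totient_dvd_of_dvd (primorial_dvd_primorial hab))
  · obtain ⟨p, hbp, hp⟩ := Nat.exists_infinite_primes (b + 1)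
    refine ⟨p, (Nat.le_sub_one_of_lt hbp).trans ?_⟩
    rw [← Nat.totient_prime hp]
    exact Nat.le_of_dvd (Nat.totient_pos.mpr (primorial_pos p))
      (Nat.totient_dvd_of_dvd hp.dvd_primorial)

theorem frequently_mul_log_mul_totient_primorial_le {c : ℝ} (hc0 : 0 < c)
    (hc : c < Real.exp Real.eulerMascheroniConstant) :
    ∃ᶠ n : ℕ in atTop, c * Real.log n * (primorial n).totient ≤ primorial n := by
  have hfloor : Tendsto (fun u : ℝ => ⌊Real.exp u⌋₊) atTop atTop :=
    tendsto_nat_floor_atTop.comp Real.tendsto_exp_atTop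
  refine hfloor.frequently ?_
  have hfreq := frequently_log_add_lt_logMertensProduct ((Real.log_lt_iff_lt_exp hc0).mpr hc)
  refine (hfreq.and_eventually (eventually_gt_atTop 0)).mono fun u ⟨hlt, hu⟩ => ?_
  have hfloor_pos : (0 : ℝ) < ⌊Real.exp u⌋₊ :=
    Nat.cast_pos.mpr (Nat.floor_pos.mpr (Real.one_le_exp hu.le))
  have hlog : Real.log ⌊Real.exp u⌋₊ ≤ u :=
    (Real.log_le_iff_le_exp hfloor_pos).mpr (Nat.floor_le (Real.exp_pos u).le)
  rw [← totient_primorial_mul_exp_logMertensProduct, mul_comm]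
  gcongr
  calc c * Real.log ⌊Real.exp u⌋₊ ≤ u * c := by
        rw [mul_comm]
        gcongr
    _ = Real.exp (Real.log u + Real.log c) := by
        rw [Real.exp_add, Real.exp_log hu, Real.exp_log hc0]
    _ ≤ Real.exp (logMertensProduct ⌊Real.exp u⌋₊) := Real.exp_le_exp.mpr hlt.le

theorem log_log_two_mul_totient_primorial_le {n : ℕ} (hn : n ≠ 0) :
    Real.log (Real.log (2 * (primorial n).totient)) ≤ 2 + Real.log n := by
  have hone : (1 : ℝ) ≤ n := Nat.one_le_cast.mpr (Nat.one_le_iff_ne_zero.mpr hn)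
  have htotient_pos : (1 : ℝ) ≤ (primorial n).totient :=
    Nat.one_le_cast.mpr (Nat.totient_pos.mpr (primorial_pos n))
  have htotient_le : ((primorial n).totient : ℝ) ≤ 4 ^ n := by
    exact_mod_cast (Nat.totient_le _).trans (primorial_le_four_pow n)
  have hlog : Real.log (2 * (primorial n).totient) ≤ 3 * n := by
    calc Real.log (2 * (primorial n).totient) ≤ Real.log (2 * 4 ^ n) :=
          Real.log_le_log (by linarith) (by linarith)
      _ = (1 + 2 * n) * Real.log 2 := by
          rw [show (4 : ℝ) = 2 ^ 2 by norm_num, ← pow_mul, ← pow_succ', Real.log_pow]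
          push_cast
          ring
      _ ≤ (1 + 2 * n) * 1 := by
          gcongr
          linarith [Real.log_two_lt_d9]
      _ ≤ 3 * n := by linarith
  calc Real.log (Real.log (2 * (primorial n).totient)) ≤ Real.log (3 * n) :=
        Real.log_le_log (Real.log_pos (by linarith)) hlog
    _ = Real.log 3 + Real.log n := Real.log_mul three_ne_zero (by positivity)
    _ ≤ 2 + Real.log n := by linarith [Real.log_le_sub_one_of_pos (three_pos (α := ℝ))]

theorem frequently_mul_totient_mul_log_log_le {c : ℝ} (hc0 : 0 < c)
    (hc : c < Real.exp Real.eulerMascheroniConstant) :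
    ∃ᶠ n : ℕ in atTop, c * (primorial n).totient *
      Real.log (Real.log (2 * (primorial n).totient)) ≤ primorial n := by
  obtain ⟨d, hcd, hd⟩ := exists_between hc
  have hlog := (Real.tendsto_log_atTop.comp tendsto_natCast_atTop_atTop).const_mul_atTop
    (sub_pos.mpr hcd)
  refine ((frequently_mul_log_mul_totient_primorial_le (hc0.trans hcd) hd).and_eventually
    ((hlog.eventually_ge_atTop (c * 2)).and (eventually_ne_atTop 0))).mono
    fun n ⟨hn, hlarge, hne⟩ => ?_
  simp only [Function.comp_apply] at hlarge
  calc c * (primorial n).totient * Real.log (Real.log (2 * (primorial n).totient))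
      ≤ c * (primorial n).totient * (2 + Real.log n) := by
        gcongr
        exact log_log_two_mul_totient_primorial_le hne
    _ = c * (2 + Real.log n) * (primorial n).totient := by ring
    _ ≤ d * Real.log n * (primorial n).totient :=
        mul_le_mul_of_nonneg_right (by linarith) (Nat.cast_nonneg _)
    _ ≤ primorial n := hn

end Totient

/-! ### Geometry of lattices -/

section CoveringRadius

variable {E : Type*} [NormedAddCommGroup E] [InnerProductSpace ℝ E]

theorem exists_int_norm_add_sub_smul_sq_le (w b : E) (t : ℝ) :
    ∃ z : ℤ, ‖w + (t - z) • b‖ ^ 2 ≤ ‖w‖ ^ 2 + ‖b‖ ^ 2 / 4 := by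
  by_contra! hlt
  set f := Int.fract t
  have hsq : ∀ c : ℝ,
      ‖w + c • b‖ ^ 2 = ‖w‖ ^ 2 + 2 * c * inner ℝ w b + c ^ 2 * ‖b‖ ^ 2 := by
    intro c
    rw [norm_add_sq_real, norm_smul, real_inner_smul_right, mul_pow, Real.norm_eq_abs, sq_abs]
    ring
  have hfloor : ‖w‖ ^ 2 + ‖b‖ ^ 2 / 4 < ‖w + f • b‖ ^ 2 := hlt ⌊t⌋
  have hceil : ‖w‖ ^ 2 + ‖b‖ ^ 2 / 4 < ‖w + (f - 1) • b‖ ^ 2 := by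
    have hsub : t - ((⌊t⌋ + 1 : ℤ) : ℝ) = f - 1 := by
      rw [Int.cast_add, Int.cast_one, ← sub_sub, Int.self_sub_floor]
    exact hsub ▸ hlt (⌊t⌋ + 1)
  -- With weights `1 - f` and `f` the inner products cancel, leaving `f (1 - f) ‖b‖² ≤ ‖b‖² / 4`.
  have havg : (1 - f) * ‖w + f • b‖ ^ 2 + f * ‖w + (f - 1) • b‖ ^ 2 =
      ‖w‖ ^ 2 + f * (1 - f) * ‖b‖ ^ 2 := by
    rw [hsq, hsq]
    ring
  have hf0 : 0 ≤ f := Int.fract_nonneg t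
  have hf1 : 0 < 1 - f := sub_pos.mpr (Int.fract_lt_one t)
  nlinarith [mul_lt_mul_of_pos_left hfloor hf1, mul_le_mul_of_nonneg_left hceil.le hf0,
    mul_nonneg (sq_nonneg (f - 1 / 2)) (sq_nonneg ‖b‖)]

theorem exists_int_norm_sum_sub_smul_sq_le {ι : Type*} (s : Finset ι) (b : ι → E) (t : ι → ℝ) :
    ∃ z : ι → ℤ, ‖∑ i ∈ s, (t i - z i) • b i‖ ^ 2 ≤ (∑ i ∈ s, ‖b i‖ ^ 2) / 4 := by
  classical
  induction s using Finset.induction_on with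
  | empty => exact ⟨0, by simp⟩
  | insert a s ha ih =>
    obtain ⟨z, hz⟩ := ih
    obtain ⟨k, hk⟩ :=
      exists_int_norm_add_sub_smul_sq_le (∑ i ∈ s, (t i - z i) • b i) (b a) (t a)
    have hupdate : ∑ i ∈ s, (t i - Function.update z a k i) • b i = ∑ i ∈ s, (t i - z i) • b i :=
      Finset.sum_congr rfl fun i hi => by
        rw [Function.update_of_ne (ne_of_mem_of_not_mem hi ha)]
    refine ⟨Function.update z a k, ?_⟩
    rw [Finset.sum_insert ha, Finset.sum_insert ha, Function.update_self, add_comm, hupdate]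
    linarith

theorem exists_mem_norm_sub_le_of_sum_norm_sq_le (L : Submodule ℤ E) {ι : Type*} [Fintype ι]
    {b : ι → E} (hb : ∀ i, b i ∈ L) (hspan : Submodule.span ℝ (Set.range b) = ⊤) {τ : ℝ}
    (hτ : 0 ≤ τ) (hle : ∑ i, ‖b i‖ ^ 2 ≤ 4 * τ ^ 2) (x : E) : ∃ y ∈ L, ‖x - y‖ ≤ τ := by
  have hx : x ∈ Submodule.span ℝ (Set.range b) := hspan ▸ Submodule.mem_top
  obtain ⟨t, rfl⟩ := (Submodule.mem_span_range_iff_exists_fun ℝ).mp hx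
  obtain ⟨z, hz⟩ := exists_int_norm_sum_sub_smul_sq_le Finset.univ b t
  refine ⟨∑ i, z i • b i, L.sum_mem fun i _ => L.smul_mem _ (hb i), ?_⟩
  have hsub : ∑ i, t i • b i - ∑ i, z i • b i = ∑ i, (t i - z i) • b i := by
    simp only [← Finset.sum_sub_distrib, ← Int.cast_smul_eq_zsmul ℝ, ← sub_smul]
  rw [hsub]
  exact abs_le_of_sq_le_sq' (by linarith) hτ |>.2

end CoveringRadius

section Covolume

open MeasureTheory Module

theorem natCast_mul_measure_le_of_card_le {G α : Type*} [AddGroup G] [Countable G]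
    [AddAction G α] [MeasurableSpace G] [MeasurableSpace α] [MeasurableVAdd G α] {μ : Measure α}
    [VAddInvariantMeasure G α μ] {F B : Set α} (hF : IsAddFundamentalDomain G F μ)
    (hB : MeasurableSet B) {n : ℕ}
    (hn : ∀ x, ∃ S : Finset G, n ≤ S.card ∧ ∀ g ∈ S, g +ᵥ x ∈ B) : n * μ F ≤ μ B := by
  have hsum : μ B = ∫⁻ x in F, ∑' g : G, B.indicator 1 (g +ᵥ x) ∂μ := by
    rw [← lintegral_indicator_one hB, hF.lintegral_eq_tsum'' (B.indicator 1), lintegral_tsum]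
    exact fun g => ((measurable_one.indicator hB).comp (measurable_const_vadd g)).aemeasurable
  rw [hsum, ← setLIntegral_const]
  refine lintegral_mono fun x => ?_
  obtain ⟨S, hcard, hS⟩ := hn x
  calc (n : ENNReal) ≤ ∑ _g ∈ S, (1 : ENNReal) := by
        simpa using hcard
    _ = ∑ g ∈ S, B.indicator 1 (g +ᵥ x) :=
        Finset.sum_congr rfl fun g hg => by rw [Set.indicator_of_mem (hS g hg), Pi.one_apply]
    _ ≤ ∑' g : G, B.indicator 1 (g +ᵥ x) := ENNReal.sum_le_tsum S

variable {E : Type*} [NormedAddCommGroup E] [InnerProductSpace ℝ E]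

theorem nondegenerate_innerₗ : LinearMap.BilinForm.Nondegenerate (innerₗ E) :=
  ⟨fun x hx => inner_self_eq_zero.mp (hx x), fun x hx => inner_self_eq_zero.mp (hx x)⟩

theorem dualLattice_eq_dualSubmodule (L : Submodule ℤ E) :
    dualLattice L = LinearMap.BilinForm.dualSubmodule (innerₗ E) L := by
  ext x
  refine forall₂_congr fun y _ => ?_
  rw [Submodule.mem_one]
  exact exists_congr fun k => eq_comm

theorem discreteTopology_dualLattice [FiniteDimensional ℝ E] {L : Submodule ℤ E}
    (hspan : Submodule.span ℝ (L : Set E) = ⊤) : DiscreteTopology (dualLattice L) := by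
  obtain ⟨s, hsL, hsspan, hindep⟩ := exists_linearIndependent ℝ (L : Set E)
  let b : Basis s ℝ E := Basis.mk hindep (by rw [Subtype.range_coe, hsspan, hspan])
  have := FiniteDimensional.fintypeBasisIndex b
  classical
  have hle : dualLattice L ≤ Submodule.span ℤ (Set.range
      (LinearMap.BilinForm.dualBasis (innerₗ E) nondegenerate_innerₗ b)) := by
    rw [← LinearMap.BilinForm.dualSubmodule_span_of_basis, ← dualLattice_eq_dualSubmodule]
    refine fun x hx y hy => hx y (Submodule.span_le.mpr ?_ hy)
    rintro _ ⟨i, rfl⟩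
    rw [Basis.mk_apply]
    exact hsL i.2
  exact DiscreteTopology.of_subset (inferInstanceAs (DiscreteTopology (Submodule.span ℤ _))) hle

theorem le_latticeMinimum [Nontrivial E] {L : Submodule ℤ E}
    (hspan : Submodule.span ℝ (L : Set E) = ⊤) {r : ℝ} (hr : ∀ x ∈ L, x ≠ 0 → r ≤ ‖x‖) :
    r ≤ latticeMinimum L := by
  refine le_csInf ?_ ?_
  · by_contra hempty
    have hzero : (L : Set E) ⊆ {0} := fun x hx => by
      by_contra hx0
      exact hempty ⟨‖x‖, x, hx, hx0, rfl⟩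
    have hbot := Submodule.span_mono (R := ℝ) hzero
    rw [hspan, Submodule.span_zero_singleton, top_le_iff] at hbot
    exact bot_ne_top hbot
  · rintro _ ⟨x, hx, hx0, rfl⟩
    exact hr x hx hx0

variable [FiniteDimensional ℝ E] [MeasurableSpace E] [BorelSpace E]

theorem covolume_span_range_eq_abs_det {ι : Type*} [Fintype ι] [DecidableEq ι]
    (o : OrthonormalBasis ι ℝ E) (b : Basis ι ℝ E) :
    ZLattice.covolume (Submodule.span ℤ (Set.range b)) = |o.toBasis.det b| := by
  have ho : volume.real (ZSpan.fundamentalDomain o.toBasis) = 1 := by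
    rw [measureReal_congr (ZSpan.fundamentalDomain_ae_parallelepiped o.toBasis volume),
      measureReal_def, OrthonormalBasis.coe_toBasis, o.volume_parallelepiped, ENNReal.toReal_one]
  rw [ZLattice.covolume_eq_measure_fundamentalDomain _ _ (ZSpan.isAddFundamentalDomain b volume),
    ZSpan.measureReal_fundamentalDomain _ _ o.toBasis, ho, mul_one]

theorem covolume_mul_covolume_dualLattice (L : Submodule ℤ E) [DiscreteTopology L]
    [IsZLattice ℝ L] : ZLattice.covolume L * ZLattice.covolume (dualLattice L) = 1 := by
  classical
  have := ZLattice.module_free ℝ L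
  have := ZLattice.module_finite ℝ L
  let b := (Free.chooseBasis ℤ L).ofZLatticeBasis ℝ
  let d := LinearMap.BilinForm.dualBasis (innerₗ E) nondegenerate_innerₗ b
  let o : OrthonormalBasis (Free.ChooseBasisIndex ℤ L) ℝ E := (stdOrthonormalBasis ℝ E).reindex
    (Fintype.equivOfCardEq (by rw [Fintype.card_fin, finrank_eq_card_basis b]))
  have hL : L = Submodule.span ℤ (Set.range b) :=
    (Basis.ofZLatticeBasis_span ℝ L (Free.chooseBasis ℤ L)).symm
  have hdual : dualLattice L = Submodule.span ℤ (Set.range d) := by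
    rw [dualLattice_eq_dualSubmodule]
    conv_lhs => rw [hL]
    exact LinearMap.BilinForm.dualSubmodule_span_of_basis _ nondegenerate_innerₗ b
  have hgram : (o.toBasis.toMatrix d).transpose * o.toBasis.toMatrix b = 1 := by
    ext i j
    have hdb : inner ℝ (d i) (b j) = (1 : Matrix _ _ ℝ) i j := by
      refine (LinearMap.BilinForm.apply_dualBasis_left nondegenerate_innerₗ b i j).trans ?_
      simp only [Matrix.one_apply, eq_comm]
    rw [← hdb, ← o.sum_inner_mul_inner, Matrix.mul_apply]
    refine Finset.sum_congr rfl fun k _ => ?_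
    rw [Matrix.transpose_apply, Basis.toMatrix_apply, Basis.toMatrix_apply,
      OrthonormalBasis.coe_toBasis_repr_apply, OrthonormalBasis.coe_toBasis_repr_apply,
      OrthonormalBasis.repr_apply_apply, OrthonormalBasis.repr_apply_apply, real_inner_comm]
  have hdet := congrArg Matrix.det hgram
  rw [Matrix.det_mul, Matrix.det_transpose, Matrix.det_one, ← Basis.det_apply,
    ← Basis.det_apply] at hdet
  rw [hdual]
  conv_lhs => enter [1]; rw [hL]
  rw [covolume_span_range_eq_abs_det o b, covolume_span_range_eq_abs_det o d, ← abs_mul, mul_comm,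
    hdet, abs_one]

theorem covolume_eq_one_of_image_eq_dualLattice (L : Submodule ℤ E) [DiscreteTopology L]
    [IsZLattice ℝ L] (σ : E ≃ₗᵢ[ℝ] E) (hσ : σ '' (L : Set E) = (dualLattice L : Set E)) :
    ZLattice.covolume L = 1 := by
  have hcomap : dualLattice L = ZLattice.comap ℝ L σ.symm.toContinuousLinearEquiv.toLinearMap := by
    refine SetLike.coe_injective (hσ.symm.trans ?_)
    exact σ.toEquiv.image_eq_preimage_symm L
  have hcovol : ZLattice.covolume (dualLattice L) = ZLattice.covolume L := by
    rw [hcomap]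
    exact ZLattice.covolume_comap L volume volume σ.symm.measurePreserving
  have hmul := covolume_mul_covolume_dualLattice L
  rw [hcovol] at hmul
  nlinarith [ZLattice.covolume_pos L volume]

theorem card_mul_covolume_le_volume_closedBall (L : Submodule ℤ E) [DiscreteTopology L]
    [IsZLattice ℝ L] {τ r : ℝ} (hτ : ∀ x : E, ∃ y ∈ L, ‖x - y‖ ≤ τ) (X : Finset L)
    (hX : ∀ x ∈ X, ‖(x : E)‖ ≤ r) :
    X.card * ZLattice.covolume L ≤ volume.real (Metric.closedBall (0 : E) (r + τ)) := by
  classical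
  have := ZLattice.module_free ℝ L
  have := ZLattice.module_finite ℝ L
  have : VAddInvariantMeasure L E volume :=
    inferInstanceAs (VAddInvariantMeasure L.toAddSubgroup E volume)
  have hF := ZLattice.isAddFundamentalDomain (Free.chooseBasis ℤ L) volume
  have hball : ∀ x : E, ∃ S : Finset L, X.card ≤ S.card ∧
      ∀ g ∈ S, g +ᵥ x ∈ Metric.closedBall (0 : E) (r + τ) := by
    intro x
    obtain ⟨y, hy, hxy⟩ := hτ x
    refine ⟨X.image (· - ⟨y, hy⟩),
      (Finset.card_image_of_injective _ sub_left_injective).ge, fun g hg => ?_⟩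
    obtain ⟨v, hv, rfl⟩ := Finset.mem_image.mp hg
    have hvadd : (v - ⟨y, hy⟩ : L) +ᵥ x = (v : E) + (x - y) := by
      change ((v : E) - y) + x = _
      abel
    rw [mem_closedBall_zero_iff, hvadd]
    exact norm_add_le_of_le (hX v hv) hxy
  have : MeasurableVAdd L E := inferInstanceAs (MeasurableVAdd L.toAddSubgroup E)
  rw [ZLattice.covolume_eq_measure_fundamentalDomain L volume hF, measureReal_def,
    measureReal_def, ← ENNReal.toReal_natCast, ← ENNReal.toReal_mul]
  exact ENNReal.toReal_mono measure_closedBall_lt_top.ne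
    (natCast_mul_measure_le_of_card_le hF Metric.isClosed_closedBall.measurableSet hball)

theorem volume_closedBall_div_le_packingDensity [Nontrivial E] {L : Submodule ℤ E}
    (hspan : Submodule.span ℝ (L : Set E) = ⊤) (hcov : ZLattice.covolume L = 1) {r : ℝ}
    (hr : ∀ x ∈ L, x ≠ 0 → r ≤ ‖x‖) :
    volume.real (Metric.closedBall (0 : E) r) / 2 ^ finrank ℝ E ≤ packingDensity L := by
  unfold packingDensity
  rw [hcov, mul_one]
  gcongr
  · exact measure_closedBall_lt_top.ne
  · exact le_latticeMinimum hspan hr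

theorem volume_real_closedBall_of_finrank_eq_two_mul [Nontrivial E] {k : ℕ}
    (hk : finrank ℝ E = 2 * k) {r : ℝ} (hr : 0 ≤ r) :
    volume.real (Metric.closedBall (0 : E) r) = (r ^ 2) ^ k * (Real.pi ^ k / k.factorial) := by
  rw [measureReal_def, InnerProductSpace.volume_closedBall_of_dim_even hk, ENNReal.toReal_mul,
    ENNReal.toReal_pow, ENNReal.toReal_ofReal hr, ENNReal.toReal_ofReal (by positivity), hk,
    pow_mul]

end Covolume

/-! ### The Euclidean space of a number field -/

section Minkowski

open Module

variable {K : Type*} [Field K] [NumberField K]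

namespace MinkowskiSpace

theorem coord_sub (x y : MinkowskiSpace K) (φ : K →+* ℂ) :
    (x - y).coord φ = x.coord φ - y.coord φ := rfl

theorem coord_neg (x : MinkowskiSpace K) (φ : K →+* ℂ) : (-x).coord φ = -x.coord φ := rfl

theorem coord_smul (r : ℝ) (x : MinkowskiSpace K) (φ : K →+* ℂ) :
    (r • x).coord φ = r * x.coord φ :=
  Complex.real_smul

omit [NumberField K] in
theorem coord_conjugate (x : MinkowskiSpace K) (φ : K →+* ℂ) :
    x.coord (NumberField.ComplexEmbedding.conjugate φ) = starRingEnd ℂ (x.coord φ) :=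
  x.2 φ

theorem norm_sq_eq (x : MinkowskiSpace K) : ‖x‖ ^ 2 = ∑ φ, ‖x.coord φ‖ ^ 2 :=
  PiLp.norm_sq_eq_of_L2 _ x.1

theorem eq_zero_of_sum_coord_mul_eq_zero (w : MinkowskiSpace K)
    (h : ∀ x : K, ∑ φ : K →+* ℂ, w.coord φ * φ x = 0) : w = 0 := by
  have hinj : Function.Injective fun φ : K →+* ℂ => (φ : K →* ℂ) := fun φ ψ hφψ =>
    RingHom.ext fun x => DFunLike.congr_fun hφψ x
  have hindep := (linearIndependent_monoidHom K ℂ).comp _ hinj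
  refine MinkowskiSpace.ext (Fintype.linearIndependent_iff.mp hindep w.coord ?_)
  ext x
  rw [Finset.sum_apply]
  exact h x

end MinkowskiSpace

variable (K) in
/-- Complex conjugation on `K_ℝ`, acting on each coordinate. It is defined for every number field,
whether or not it restricts to an automorphism of `K`. -/
noncomputable def minkowskiConj : MinkowskiSpace K →ₗ[ℝ] MinkowskiSpace K where
  toFun x := ⟨WithLp.toLp 2 fun φ => starRingEnd ℂ (x.coord φ), fun φ =>
    congrArg (starRingEnd ℂ) (x.coord_conjugate φ)⟩
  map_add' x y := by
    ext φ
    exact map_add (starRingEnd ℂ) (x.coord φ) (y.coord φ)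
  map_smul' c x := by
    ext φ
    change starRingEnd ℂ (c • x.coord φ) = c • starRingEnd ℂ (x.coord φ)
    simp

theorem minkowskiConj_coord (x : MinkowskiSpace K) (φ : K →+* ℂ) :
    (minkowskiConj K x).coord φ = starRingEnd ℂ (x.coord φ) := rfl

theorem minkowskiConj_minkowskiConj (x : MinkowskiSpace K) :
    minkowskiConj K (minkowskiConj K x) = x := by
  ext φ
  simp only [minkowskiConj_coord, Complex.conj_conj]

theorem norm_minkowskiConj (x : MinkowskiSpace K) : ‖minkowskiConj K x‖ = ‖x‖ := by
  rw [← sq_eq_sq₀ (norm_nonneg _) (norm_nonneg _), MinkowskiSpace.norm_sq_eq,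
    MinkowskiSpace.norm_sq_eq]
  simp only [minkowskiConj_coord, RCLike.norm_conj]

theorem toMinkowski_coord (x : K) (φ : K →+* ℂ) : (toMinkowski K x).coord φ = φ x := rfl

theorem toMinkowski_injective : Function.Injective (toMinkowski K) := fun x y h => by
  obtain ⟨φ⟩ : Nonempty (K →+* ℂ) := inferInstance
  exact φ.injective (congrArg (fun v => v.coord φ) h)

theorem toMinkowski_rat_smul (r : ℚ) (x : K) :
    toMinkowski K (r • x) = (r : ℝ) • toMinkowski K x := by
  ext φ
  rw [MinkowskiSpace.coord_smul, toMinkowski_coord, toMinkowski_coord, map_rat_smul,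
    Rat.smul_def, Complex.ofReal_ratCast]

theorem norm_sq_toMinkowski (x : K) : ‖toMinkowski K x‖ ^ 2 = ∑ φ : K →+* ℂ, ‖φ x‖ ^ 2 :=
  MinkowskiSpace.norm_sq_eq _

theorem sum_embeddings_eq_trace (x : K) :
    ∑ φ : K →+* ℂ, φ x = ((Algebra.trace ℚ K x : ℚ) : ℂ) := by
  rw [← eq_ratCast (algebraMap ℚ ℂ), trace_eq_sum_embeddings ℂ,
    ← (RingHom.equivRatAlgHom K ℂ).sum_comp]
  rfl

theorem sum_toMinkowski_coord_mul (x y : K) :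
    ∑ φ : K →+* ℂ, (toMinkowski K x).coord φ * φ y = ((Algebra.trace ℚ K (x * y) : ℚ) : ℂ) := by
  simp only [toMinkowski_coord, ← map_mul, sum_embeddings_eq_trace]

theorem span_range_toMinkowski : Submodule.span ℝ (Set.range (toMinkowski K)) = ⊤ := by
  rw [← Submodule.orthogonal_eq_bot_iff, Submodule.eq_bot_iff]
  intro w hw
  rw [Submodule.mem_orthogonal] at hw
  have hconj : minkowskiConj K w = 0 := by
    refine MinkowskiSpace.eq_zero_of_sum_coord_mul_eq_zero _ fun x => ?_
    have hinner := MinkowskiSpace.inner_eq K (toMinkowski K x) w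
    rw [hw _ (Submodule.subset_span ⟨x, rfl⟩), Complex.ofReal_zero] at hinner
    simpa only [minkowskiConj_coord, toMinkowski_coord, mul_comm] using hinner.symm
  rw [← minkowskiConj_minkowskiConj w, hconj, map_zero]

theorem span_range_toMinkowski_basis {ι : Type*} [Finite ι] (b : Basis ι ℚ K) :
    Submodule.span ℝ (Set.range fun i => toMinkowski K (b i)) = ⊤ := by
  have := Fintype.ofFinite ι
  rw [eq_top_iff, ← span_range_toMinkowski, Submodule.span_le]
  rintro _ ⟨x, rfl⟩
  rw [← b.sum_repr x, map_sum]
  refine Submodule.sum_mem _ fun i _ => ?_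
  rw [toMinkowski_rat_smul]
  exact Submodule.smul_mem _ _ (Submodule.subset_span ⟨i, rfl⟩)

theorem finrank_minkowskiSpace : finrank ℝ (MinkowskiSpace K) = finrank ℚ K := by
  let b := NumberField.integralBasis K
  let coords : MinkowskiSpace K →ₗ[ℝ] ((K →+* ℂ) → ℂ) :=
    { toFun := fun x φ => x.coord φ
      map_add' := fun _ _ => rfl
      map_smul' := fun _ _ => rfl }
  have hcoords : coords ∘ (fun i => toMinkowski K (b i)) =
      NumberField.canonicalEmbedding.latticeBasis K := by
    ext i φ
    rw [NumberField.canonicalEmbedding.latticeBasis_apply]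
    rfl
  have hindep : LinearIndependent ℝ fun i => toMinkowski K (b i) := by
    refine LinearIndependent.of_comp coords ?_
    rw [hcoords]
    exact (NumberField.canonicalEmbedding.latticeBasis K).linearIndependent.restrict_scalars
      (by simp [Function.Injective])
  rw [finrank_eq_card_basis (Basis.mk hindep (span_range_toMinkowski_basis b).ge),
    finrank_eq_card_basis b]

theorem exists_trace_mul_eq (f : K →ₗ[ℚ] ℚ) : ∃ y : K, ∀ x, Algebra.trace ℚ K (y * x) = f x := by
  have hnondeg := traceForm_nondegenerate ℚ K
  refine ⟨((Algebra.traceForm ℚ K).toDual hnondeg).symm f, fun x => ?_⟩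
  rw [← Algebra.traceForm_apply]
  exact LinearMap.BilinForm.apply_toDual_symm_apply (hB := hnondeg) f x

theorem exists_eq_toMinkowski_of_rational_pairing {ι : Type*} (b : Basis ι ℚ K)
    (w : MinkowskiSpace K) (h : ∀ i, ∃ r : ℚ, ∑ φ : K →+* ℂ, w.coord φ * φ (b i) = r) :
    ∃ y, w = toMinkowski K y := by
  choose r hr using h
  obtain ⟨y, hy⟩ := exists_trace_mul_eq (b.constr ℚ r)
  let pairing : K →ₗ[ℚ] ℂ := AddMonoidHom.toRatLinearMap
    (∑ φ : K →+* ℂ, (AddMonoidHom.mulLeft ((w - toMinkowski K y).coord φ)).comp (φ : K →+ ℂ))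
  have hpairing (x : K) : pairing x = ∑ φ : K →+* ℂ, (w - toMinkowski K y).coord φ * φ x := by
    simp [pairing]
  have hzero : pairing = 0 := b.ext fun i => by
    rw [hpairing]
    simp only [MinkowskiSpace.coord_sub, sub_mul, Finset.sum_sub_distrib,
      sum_toMinkowski_coord_mul]
    rw [hr, hy, Basis.constr_basis, sub_self, LinearMap.zero_apply]
  refine ⟨y, sub_eq_zero.mp (MinkowskiSpace.eq_zero_of_sum_coord_mul_eq_zero _ fun x => ?_)⟩
  rw [← hpairing, hzero, LinearMap.zero_apply]

theorem exists_eq_toMinkowski_of_integral_pairing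
    {I : FractionalIdeal (nonZeroDivisors (𝓞 K)) K} (hI : I ≠ 0) (w : MinkowskiSpace K)
    (h : ∀ a ∈ I, ∃ k : ℤ, ∑ φ : K →+* ℂ, w.coord φ * φ a = k) :
    ∃ x ∈ FractionalIdeal.dual ℤ ℚ I, w = toMinkowski K x := by
  let b := NumberField.basisOfFractionalIdeal K (Units.mk0 I hI)
  have hb (i) : b i ∈ I := by
    rw [NumberField.basisOfFractionalIdeal_apply]
    exact (NumberField.fractionalIdealBasis K _ i).2
  obtain ⟨y, rfl⟩ := exists_eq_toMinkowski_of_rational_pairing b w fun i => by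
    obtain ⟨k, hk⟩ := h _ (hb i)
    exact ⟨k, by rw [hk, Rat.cast_intCast]⟩
  refine ⟨y, (FractionalIdeal.mem_dual hI).mpr fun a ha => ?_, rfl⟩
  obtain ⟨k, hk⟩ := h a ha
  rw [sum_toMinkowski_coord_mul] at hk
  refine ⟨k, ?_⟩
  rw [Algebra.traceForm_apply, eq_intCast]
  exact_mod_cast hk.symm

end Minkowski

/-! ### Lines modulo a maximal ideal -/

section FractionalIdeals

open scoped nonZeroDivisors

open FractionalIdeal

theorem mem_or_mem_smul_of_smul_mem {R M : Type*} [CommRing R] [AddCommGroup M] [Module R M]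
    {P : Ideal R} (hP : P.IsMaximal) {N : Submodule R M} {r : R} {y : M} (hy : y ∈ N)
    (h : r • y ∈ P • N) : r ∈ P ∨ y ∈ P • N := by
  refine or_iff_not_imp_left.mpr fun hr => ?_
  obtain ⟨s, p, hp, hsp⟩ := hP.exists_inv hr
  rw [← one_smul R y, ← hsp, add_smul, mul_smul]
  exact Submodule.add_mem _ (Submodule.smul_mem _ s h) (Submodule.smul_mem_smul hp hy)

theorem smul_prod_submodule {R M M' : Type*} [CommRing R] [AddCommGroup M] [Module R M]
    [AddCommGroup M'] [Module R M'] (I : Ideal R) (N : Submodule R M) (N' : Submodule R M') :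
    I • N.prod N' = (I • N).prod (I • N') := by
  have hprod (A : Submodule R M) (B : Submodule R M') :
      A.prod B = A.map (LinearMap.inl R M M') ⊔ B.map (LinearMap.inr R M M') := by
    rw [Submodule.map_inl, Submodule.map_inr, Submodule.prod_sup_prod, sup_bot_eq, bot_sup_eq]
  rw [hprod, hprod, Submodule.smul_sup, Submodule.map_smul'', Submodule.map_smul'']

theorem smul_coe_fractionalIdeal {R K : Type*} [CommRing R] [CommRing K] [Algebra R K]
    (S : Submonoid R) (I : Ideal R) (J : FractionalIdeal S K) :
    I • (J : Submodule R K) = ((I * J : FractionalIdeal S K) : Submodule R K) := by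
  refine le_antisymm (Submodule.smul_le.mpr fun r hr x hx => ?_) ?_
  · rw [Algebra.smul_def]
    exact mul_mem_mul (mem_coeIdeal_of_mem S hr) hx
  · rw [coe_mul, Submodule.mul_le]
    rintro x hx y hy
    obtain ⟨r, hr, rfl⟩ := (mem_coeIdeal S).mp hx
    rw [← Algebra.smul_def]
    exact Submodule.smul_mem_smul hr hy

variable {R K : Type*} [CommRing R] [IsDedekindDomain R] [Field K] [Algebra R K]
  [IsFractionRing R K]

omit [IsDedekindDomain R] in
theorem algebraMap_mem_coeIdeal_iff {I : Ideal R} {r : R} :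
    algebraMap R K r ∈ (I : FractionalIdeal R⁰ K) ↔ r ∈ I :=
  (IsFractionRing.injective R K).mem_set_image

theorem exists_sub_smul_mem_of_notMem {P : Ideal R} (hP : P.IsMaximal)
    {J : FractionalIdeal R⁰ K} {x : K} (hx : x ∈ J)
    (hxP : x ∉ (P : FractionalIdeal R⁰ K) * J) {y : K} (hy : y ∈ J) :
    ∃ s : R, y - s • x ∈ (P : FractionalIdeal R⁰ K) * J := by
  have hJ : J ≠ 0 := by
    rintro rfl
    exact hxP (by simpa using hx)
  obtain ⟨I, hI⟩ := le_one_iff_exists_coeIdeal.mp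
    (show spanSingleton R⁰ x * J⁻¹ ≤ 1 by
      rw [← mul_inv_cancel₀ hJ]
      gcongr
      exact spanSingleton_le_iff_mem.mpr hx)
  have hIJ : (I : FractionalIdeal R⁰ K) * J = spanSingleton R⁰ x := by
    rw [hI, mul_assoc, inv_mul_cancel₀ hJ, mul_one]
  have hIP : ¬ I ≤ P := fun hle => hxP <| spanSingleton_le_iff_mem.mp <| by
    rw [← hIJ]
    gcongr
  have hsup : I ⊔ P = ⊤ := hP.out.2 _ (right_lt_sup.mpr hIP)
  have hadd : spanSingleton R⁰ x + P * J = J := by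
    rw [← hIJ, ← add_mul, ← coeIdeal_sup, hsup, coeIdeal_top, one_mul]
  rw [← hadd] at hy
  obtain ⟨_, hu, v, hv, rfl⟩ := (mem_add _ _ _).mp hy
  obtain ⟨s, rfl⟩ := (mem_spanSingleton _).mp hu
  exact ⟨s, by rwa [add_sub_cancel_left]⟩

end FractionalIdeals

section Determinant

open scoped nonZeroDivisors

open FractionalIdeal

variable {K : Type*} [Field K]

/-- The determinant of two vectors of `K²`, the alternating form behind the symplectic isometry
`planeRotation`. -/
def planeDet (v w : K × K) : K := v.1 * w.2 - v.2 * w.1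

theorem planeDet_swap (v w : K × K) : planeDet v w = -planeDet w v := by
  simp only [planeDet]
  ring

theorem planeDet_add_right (v w w' : K × K) :
    planeDet v (w + w') = planeDet v w + planeDet v w' := by
  simp only [planeDet, Prod.fst_add, Prod.snd_add]
  ring

theorem planeDet_smul_right {R : Type*} [CommSemiring R] [Algebra R K] (r : R) (v w : K × K) :
    planeDet v (r • w) = r • planeDet v w := by
  simp only [planeDet, Prod.smul_fst, Prod.smul_snd, mul_smul_comm]
  simp only [Algebra.smul_def, mul_sub]

variable [NumberField K]

theorem ne_bot_of_isMaximal {P : Ideal (𝓞 K)} (hP : P.IsMaximal) : P ≠ ⊥ :=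
  Ring.ne_bot_of_isMaximal_of_not_isField hP (NumberField.RingOfIntegers.not_isField K)

variable (K) in
/-- The dual `𝓞_K^#` of `𝓞_K` for the trace form. -/
noncomputable abbrev codifferent : FractionalIdeal (𝓞 K)⁰ K := FractionalIdeal.dual ℤ ℚ 1

theorem codifferent_ne_zero : codifferent K ≠ 0 := dual_ne_zero ℤ ℚ one_ne_zero

theorem mem_codifferent {x : K} :
    x ∈ codifferent K ↔ ∀ s : 𝓞 K, ∃ k : ℤ, Algebra.trace ℚ K (s • x) = k := by
  rw [mem_dual (one_ne_zero : (1 : FractionalIdeal (𝓞 K)⁰ K) ≠ 0)]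
  constructor
  · intro h s
    obtain ⟨k, hk⟩ := h _ ((mem_one_iff _).mpr ⟨s, rfl⟩)
    exact ⟨k, by rw [Algebra.smul_def, mul_comm, ← Algebra.traceForm_apply, ← hk, eq_intCast]⟩
  · intro h a ha
    obtain ⟨s, rfl⟩ := (mem_one_iff _).mp ha
    obtain ⟨k, hk⟩ := h s
    exact ⟨k, by rw [Algebra.traceForm_apply, mul_comm, ← Algebra.smul_def, hk, eq_intCast]⟩

/-- The fractional ideal `P⁻¹ 𝓞_K^#`. -/
noncomputable abbrev polarIdeal (P : Ideal (𝓞 K)) : FractionalIdeal (𝓞 K)⁰ K :=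
  (P : FractionalIdeal (𝓞 K)⁰ K)⁻¹ * codifferent K

/-- The submodule `𝓞_K × P⁻¹ 𝓞_K^#` of `K²`, whose image in `K_ℝ²` is `Λ₀`. -/
noncomputable def baseModule (P : Ideal (𝓞 K)) : Submodule (𝓞 K) (K × K) :=
  ((1 : FractionalIdeal (𝓞 K)⁰ K) : Submodule (𝓞 K) K).prod (polarIdeal P)

variable {P : Ideal (𝓞 K)} {v w : K × K}

theorem mul_polarIdeal (hP0 : P ≠ ⊥) :
    (P : FractionalIdeal (𝓞 K)⁰ K) * polarIdeal P = codifferent K := by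
  rw [← mul_assoc, mul_inv_cancel₀ (coeIdeal_ne_zero.mpr hP0), one_mul]

theorem polarIdeal_ne_zero (hP0 : P ≠ ⊥) : polarIdeal P ≠ 0 :=
  mul_ne_zero (inv_ne_zero (coeIdeal_ne_zero.mpr hP0)) codifferent_ne_zero

theorem smul_baseModule (hP0 : P ≠ ⊥) : P • baseModule P =
    ((P : FractionalIdeal (𝓞 K)⁰ K) : Submodule (𝓞 K) K).prod (codifferent K) := by
  rw [baseModule, smul_prod_submodule, smul_coe_fractionalIdeal, smul_coe_fractionalIdeal, mul_one,
    mul_polarIdeal hP0]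

theorem mem_smul_baseModule (hP0 : P ≠ ⊥) : v ∈ P • baseModule P ↔
    v.1 ∈ (P : FractionalIdeal (𝓞 K)⁰ K) ∧ v.2 ∈ codifferent K := by
  rw [smul_baseModule hP0]
  exact Iff.rfl

theorem planeDet_mem_polarIdeal (hv : v ∈ baseModule P) (hw : w ∈ baseModule P) :
    planeDet v w ∈ polarIdeal P := by
  obtain ⟨r, hr⟩ := (mem_one_iff _).mp hv.1
  obtain ⟨s, hs⟩ := (mem_one_iff _).mp hw.1
  rw [planeDet, ← hr, ← hs, mul_comm v.2, ← Algebra.smul_def, ← Algebra.smul_def]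
  exact Submodule.sub_mem _ (Submodule.smul_mem _ r hw.2) (Submodule.smul_mem _ s hv.2)

theorem smul_polarIdeal (hP0 : P ≠ ⊥) :
    P • (polarIdeal P : Submodule (𝓞 K) K) = codifferent K := by
  rw [smul_coe_fractionalIdeal, mul_polarIdeal hP0]

theorem planeDet_mem_codifferent (hP0 : P ≠ ⊥) (hv : v ∈ baseModule P)
    (hw : w ∈ P • baseModule P) : planeDet v w ∈ codifferent K := by
  rw [← FractionalIdeal.mem_coe, ← smul_polarIdeal hP0]
  induction hw using Submodule.smul_induction_on' with
  | smul p hp w hw =>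
    rw [planeDet_smul_right]
    exact Submodule.smul_mem_smul hp (planeDet_mem_polarIdeal hv hw)
  | add w _ w' _ hw hw' =>
    rw [planeDet_add_right]
    exact Submodule.add_mem _ hw hw'

theorem mem_or_mem_codifferent_of_mul_mem (hP : P.IsMaximal) {a b : K}
    (ha : a ∈ (1 : FractionalIdeal (𝓞 K)⁰ K)) (hb : b ∈ polarIdeal P)
    (h : a * b ∈ codifferent K) :
    a ∈ (P : FractionalIdeal (𝓞 K)⁰ K) ∨ b ∈ codifferent K := by
  obtain ⟨r, rfl⟩ := (mem_one_iff _).mp ha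
  rw [← Algebra.smul_def] at h
  have hsmul := smul_polarIdeal (ne_bot_of_isMaximal hP)
  simp only [← FractionalIdeal.mem_coe (I := codifferent K), ← hsmul] at h ⊢
  exact (mem_or_mem_smul_of_smul_mem hP hb h).imp_left (mem_coeIdeal_of_mem _)

/-- The determinant is a nondegenerate alternating form on the plane `baseModule P` modulo `P`, so
a class orthogonal to a nonzero class is proportional to it. -/
theorem exists_sub_smul_mem_of_planeDet_mem (hP : P.IsMaximal) (hv : v ∈ baseModule P)
    (hw : w ∈ baseModule P) (hwP : w ∉ P • baseModule P) (h : planeDet v w ∈ codifferent K) :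
    ∃ s : 𝓞 K, v - s • w ∈ P • baseModule P := by
  have hP0 := ne_bot_of_isMaximal hP
  simp only [mem_smul_baseModule hP0] at hwP ⊢
  by_cases hw₂ : w.2 ∈ codifferent K
  · obtain ⟨s, hs⟩ := exists_sub_smul_mem_of_notMem (J := 1) hP hw.1
      (by rw [mul_one]; exact fun hw₁ => hwP ⟨hw₁, hw₂⟩) hv.1
    rw [mul_one] at hs
    have hmul : w.1 * v.2 ∈ codifferent K := by
      rw [show w.1 * v.2 = v.1 * w.2 - planeDet v w by rw [planeDet]; ring]
      obtain ⟨r, hr⟩ := (mem_one_iff _).mp hv.1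
      rw [← hr, ← Algebra.smul_def]
      exact Submodule.sub_mem _ (Submodule.smul_mem _ r hw₂) h
    have hv₂ := (mem_or_mem_codifferent_of_mul_mem hP hw.1 hv.2 hmul).resolve_left
      fun hw₁ => hwP ⟨hw₁, hw₂⟩
    exact ⟨s, hs, Submodule.sub_mem _ hv₂ (Submodule.smul_mem _ s hw₂)⟩
  · obtain ⟨s, hs⟩ := exists_sub_smul_mem_of_notMem hP hw.2
      (by rwa [mul_polarIdeal hP0]) hv.2
    rw [mul_polarIdeal hP0] at hs
    have hmul : (v.1 - s • w.1) * w.2 ∈ codifferent K := by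
      rw [show (v.1 - s • w.1) * w.2 = planeDet v w + w.1 * (v.2 - s • w.2) by
        simp only [planeDet, Algebra.smul_def]; ring]
      obtain ⟨r, hr⟩ := (mem_one_iff _).mp hw.1
      rw [← hr, ← Algebra.smul_def]
      exact Submodule.add_mem _ h (Submodule.smul_mem _ r hs)
    have hv₁ : v.1 - s • w.1 ∈ (1 : FractionalIdeal (𝓞 K)⁰ K) :=
      Submodule.sub_mem _ hv.1 (Submodule.smul_mem _ s hw.1)
    exact ⟨s, (mem_or_mem_codifferent_of_mul_mem hP hv₁ hw.2 hmul).resolve_right hw₂, hs⟩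

/-- The preimage in `baseModule P` of the line spanned by the class of `w` modulo `P`. -/
noncomputable def lineModule (P : Ideal (𝓞 K)) (w : K × K) : Submodule (𝓞 K) (K × K) :=
  Submodule.span (𝓞 K) {w} ⊔ P • baseModule P

theorem mem_lineModule : v ∈ lineModule P w ↔ ∃ s : 𝓞 K, v - s • w ∈ P • baseModule P := by
  rw [lineModule, Submodule.mem_sup]
  constructor
  · rintro ⟨_, hu, p, hp, rfl⟩
    obtain ⟨s, rfl⟩ := Submodule.mem_span_singleton.mp hu
    exact ⟨s, by rwa [add_sub_cancel_left]⟩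
  · rintro ⟨s, hs⟩
    exact ⟨_, Submodule.mem_span_singleton.mpr ⟨s, rfl⟩, _, hs, add_sub_cancel _ _⟩

theorem lineModule_le_baseModule (hw : w ∈ baseModule P) : lineModule P w ≤ baseModule P :=
  sup_le ((Submodule.span_singleton_le_iff_mem _ _).mpr hw) Submodule.smul_le_right

theorem planeDet_mem_codifferent_of_mem_lineModule (hP0 : P ≠ ⊥) (hw : w ∈ baseModule P)
    {u : K × K} (hv : v ∈ lineModule P w) (hu : u ∈ lineModule P w) :
    planeDet v u ∈ codifferent K := by
  have hright {x : K × K} (hx : x ∈ baseModule P) (hxw : planeDet x w ∈ codifferent K) {y : K × K}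
      (hy : y ∈ lineModule P w) : planeDet x y ∈ codifferent K := by
    obtain ⟨s, hs⟩ := mem_lineModule.mp hy
    rw [← add_sub_cancel (s • w) y, planeDet_add_right, planeDet_smul_right]
    exact Submodule.add_mem _ (Submodule.smul_mem _ s hxw) (planeDet_mem_codifferent hP0 hx hs)
  have hwv : planeDet w v ∈ codifferent K := by
    refine hright hw ?_ hv
    rw [planeDet, mul_comm, sub_self]
    exact Submodule.zero_mem _
  refine hright (lineModule_le_baseModule hw hv) ?_ hu
  rw [planeDet_swap]
  exact Submodule.neg_mem _ hwv

end Determinant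

/-! ### The lattices of lines -/

section Plane

open Module FractionalIdeal

variable {K : Type*} [Field K] [NumberField K]

variable (K) in
/-- The isometry `(x₁, x₂) ↦ (-conj x₂, conj x₁)` of `K_ℝ²`, which turns the scalar product into
the trace of the determinant. -/
noncomputable def planeRotation : MinkowskiPlane K ≃ₗᵢ[ℝ] MinkowskiPlane K :=
  let rotation : MinkowskiPlane K →ₗ[ℝ] MinkowskiPlane K :=
    { toFun := fun x => WithLp.toLp 2 (-minkowskiConj K x.snd, minkowskiConj K x.fst)
      map_add' := fun x y => by
        refine (WithLp.equiv 2 _).injective (Prod.ext ?_ ?_)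
        · simp [add_comm]
        · simp
      map_smul' := fun c x => by
        refine (WithLp.equiv 2 _).injective (Prod.ext ?_ ?_) <;> simp }
  have rotation_rotation (x) : rotation (rotation x) = -x := by
    refine (WithLp.equiv 2 _).injective (Prod.ext ?_ ?_) <;>
      simp [rotation, minkowskiConj_minkowskiConj]
  { toLinearEquiv := LinearEquiv.ofLinearMap rotation (-rotation)
      (by ext1 x; simp [rotation_rotation]) (by ext1 x; simp [rotation_rotation])
    norm_map' := fun x => by
      rw [← sq_eq_sq₀ (norm_nonneg _) (norm_nonneg _), WithLp.prod_norm_sq_eq_of_L2,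
        WithLp.prod_norm_sq_eq_of_L2]
      simp [rotation, norm_minkowskiConj, add_comm] }

theorem planeRotation_fst (x : MinkowskiPlane K) :
    (planeRotation K x).fst = -minkowskiConj K x.snd := rfl

theorem planeRotation_snd (x : MinkowskiPlane K) :
    (planeRotation K x).snd = minkowskiConj K x.fst := rfl

theorem planeRotation_planeRotation (x : MinkowskiPlane K) :
    planeRotation K (planeRotation K x) = -x := by
  refine (WithLp.equiv 2 _).injective (Prod.ext ?_ ?_) <;>
    simp [planeRotation_fst, planeRotation_snd, minkowskiConj_minkowskiConj]

theorem inner_planeRotation (x y : MinkowskiPlane K) :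
    ((inner ℝ (planeRotation K x) y : ℝ) : ℂ) =
      ∑ φ, (x.fst.coord φ * y.snd.coord φ - x.snd.coord φ * y.fst.coord φ) := by
  have hinner : inner ℝ (planeRotation K x) y =
      inner ℝ (-minkowskiConj K x.snd) y.fst + inner ℝ (minkowskiConj K x.fst) y.snd := rfl
  rw [hinner, inner_neg_left, real_inner_comm, real_inner_comm y.snd, Complex.ofReal_add,
    Complex.ofReal_neg, MinkowskiSpace.inner_eq, MinkowskiSpace.inner_eq, ← Finset.sum_neg_distrib,
    ← Finset.sum_add_distrib]
  refine Finset.sum_congr rfl fun φ _ => ?_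
  rw [minkowskiConj_coord, minkowskiConj_coord, Complex.conj_conj, Complex.conj_conj]
  ring

/-- The map `(a, b) ↦ (α⁻¹ a, α b)` from `K²` to `K_ℝ²`. -/
noncomputable def planeMap (α : ℝ) : K × K →ₗ[𝓞 K] MinkowskiPlane K where
  toFun v := WithLp.toLp 2 (α⁻¹ • toMinkowski K v.1, α • toMinkowski K v.2)
  map_add' v w := by
    refine (WithLp.equiv 2 _).injective (Prod.ext ?_ ?_) <;> simp
  map_smul' s v := by
    refine (WithLp.equiv 2 _).injective (Prod.ext ?_ ?_) <;> simp [smul_comm _ s]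

theorem planeMap_fst (α : ℝ) (v : K × K) : (planeMap α v).fst = α⁻¹ • toMinkowski K v.1 := rfl

theorem planeMap_snd (α : ℝ) (v : K × K) : (planeMap α v).snd = α • toMinkowski K v.2 := rfl

theorem planeMap_injective {α : ℝ} (hα : α ≠ 0) :
    Function.Injective (planeMap α : K × K →ₗ[𝓞 K] MinkowskiPlane K) := fun _ _ h =>
  Prod.ext
    (toMinkowski_injective (smul_right_injective _ (inv_ne_zero hα) (congrArg WithLp.fst h)))
    (toMinkowski_injective (smul_right_injective _ hα (congrArg WithLp.snd h)))

theorem norm_sq_planeMap (α : ℝ) (v : K × K) : ‖planeMap α v‖ ^ 2 =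
    α⁻¹ ^ 2 * ‖toMinkowski K v.1‖ ^ 2 + α ^ 2 * ‖toMinkowski K v.2‖ ^ 2 := by
  rw [WithLp.prod_norm_sq_eq_of_L2, planeMap_fst, planeMap_snd, norm_smul, norm_smul, mul_pow,
    mul_pow, Real.norm_eq_abs, Real.norm_eq_abs, sq_abs, sq_abs]

theorem inner_planeRotation_planeMap {α : ℝ} (hα : α ≠ 0) (v w : K × K) :
    inner ℝ (planeRotation K (planeMap α v)) (planeMap α w) =
      ((Algebra.trace ℚ K (planeDet v w) : ℚ) : ℝ) := by
  have hα' : (α : ℂ) ≠ 0 := mod_cast hα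
  have hinner := inner_planeRotation (planeMap α v) (planeMap α w)
  simp only [planeMap_fst, planeMap_snd, MinkowskiSpace.coord_smul, toMinkowski_coord,
    Complex.ofReal_inv] at hinner
  refine Complex.ofReal_injective (hinner.trans ?_)
  rw [Complex.ofReal_ratCast, ← sum_embeddings_eq_trace]
  refine Finset.sum_congr rfl fun φ _ => ?_
  rw [planeDet, map_sub, map_mul, map_mul]
  field_simp

variable {P : Ideal (𝓞 K)}

theorem scalingFactor_pos (hP0 : P ≠ ⊥) : 0 < scalingFactor P := by
  have hdiscr : (NumberField.discr K : ℝ) ≠ 0 := mod_cast NumberField.discr_ne_zero K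
  have hcard : 0 < Nat.card (𝓞 K ⧸ P) := by
    have := Ideal.finiteQuotientOfFreeOfNeBot P hP0
    exact Nat.card_pos
  unfold scalingFactor
  positivity

theorem baseLattice_eq_map (P : Ideal (𝓞 K)) :
    baseLattice P = (baseModule P).map (planeMap (scalingFactor P)) := by
  ext x
  have hmem : x ∈ baseLattice P ↔ x.fst ∈ (scalingFactor P)⁻¹ • idealLattice K 1 ∧
      x.snd ∈ scalingFactor P • idealLattice K (polarIdeal P) := Iff.rfl
  rw [hmem, Submodule.mem_smul_pointwise_iff_exists, Submodule.mem_smul_pointwise_iff_exists]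
  constructor
  · rintro ⟨⟨_, ⟨a, ha, rfl⟩, hfst⟩, ⟨_, ⟨b, hb, rfl⟩, hsnd⟩⟩
    exact ⟨(a, b), ⟨ha, hb⟩, (WithLp.equiv 2 _).injective (Prod.ext hfst hsnd)⟩
  · rintro ⟨v, hv, rfl⟩
    exact ⟨⟨_, ⟨v.1, hv.1, rfl⟩, rfl⟩, ⟨_, ⟨v.2, hv.2, rfl⟩, rfl⟩⟩

variable (P) in
/-- The class in `Λ₀ / P Λ₀` of the image in `Λ₀` of a vector of `𝓞_K × P⁻¹ 𝓞_K^#`. -/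
noncomputable def codeClass : baseModule P →ₗ[𝓞 K] CodeSpace P :=
  (Submodule.mkQ _).comp ((planeMap (scalingFactor P)).restrict fun v hv => by
    rw [baseLattice_eq_map]
    exact Submodule.mem_map_of_mem hv)

theorem codeClass_surjective : Function.Surjective (codeClass P) := by
  refine (Submodule.mkQ_surjective _).comp fun x => ?_
  obtain ⟨v, hv, hvx⟩ := (baseLattice_eq_map P).le x.2
  exact ⟨⟨v, hv⟩, Subtype.ext hvx⟩

theorem codeClass_eq_zero_iff (hP0 : P ≠ ⊥) {v : baseModule P} :
    codeClass P v = 0 ↔ (v : K × K) ∈ P • baseModule P := by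
  refine (Submodule.Quotient.mk_eq_zero _).trans ?_
  rw [Submodule.mem_smul_top_iff]
  have hsmul : P • baseLattice P = (P • baseModule P).map (planeMap (scalingFactor P)) := by
    rw [baseLattice_eq_map, Submodule.map_smul'']
  change planeMap (scalingFactor P) (v : K × K) ∈ P • baseLattice P ↔ _
  rw [hsmul]
  exact (planeMap_injective (scalingFactor_pos hP0).ne').mem_set_image

theorem mk_smul_codeClass (s : 𝓞 K) (v : baseModule P) :
    Ideal.Quotient.mk P s • codeClass P v = codeClass P (s • v) :=
  (map_smul (codeClass P) s v).symm

theorem mem_codeLattice {C : Submodule (𝓞 K ⧸ P) (CodeSpace P)} {x : MinkowskiPlane K} :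
    x ∈ codeLattice P C ↔
      ∃ v : baseModule P, codeClass P v ∈ C ∧ planeMap (scalingFactor P) v = x := by
  constructor
  · rintro ⟨y, hy, rfl⟩
    obtain ⟨v, hv, hvy⟩ := (baseLattice_eq_map P).le y.2
    have hclass : codeClass P ⟨v, hv⟩ = Submodule.mkQ _ y :=
      congrArg (Submodule.mkQ _) (Subtype.ext hvy)
    exact ⟨⟨v, hv⟩, by rw [hclass]; exact hy, hvy⟩
  · rintro ⟨v, hv, rfl⟩
    exact ⟨_, hv, rfl⟩

theorem exists_mem_codeLattice_iff (hP : P.IsMaximal)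
    {C : Submodule (𝓞 K ⧸ P) (CodeSpace P)} (hC : finrank (𝓞 K ⧸ P) C = 1) :
    ∃ w ∈ baseModule P, w ∉ P • baseModule P ∧ ∀ x, x ∈ codeLattice P C ↔
      x ∈ (lineModule P w).map (planeMap (scalingFactor P)) := by
  let _ := Ideal.Quotient.field P
  have hP0 := ne_bot_of_isMaximal hP
  obtain ⟨⟨c, hcC⟩, hc0, hcspan⟩ := finrank_eq_one_iff'.mp hC
  obtain ⟨w, rfl⟩ := codeClass_surjective c
  refine ⟨w, w.2, fun hw => hc0 (Subtype.ext ((codeClass_eq_zero_iff hP0).mpr hw)), fun x => ?_⟩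
  have hline (v : baseModule P) : codeClass P v ∈ C ↔ (v : K × K) ∈ lineModule P w := by
    have hclass (s : 𝓞 K) : (v : K × K) - s • (w : K × K) ∈ P • baseModule P ↔
        codeClass P v = Ideal.Quotient.mk P s • codeClass P w := by
      rw [mk_smul_codeClass, ← sub_eq_zero, ← map_sub, codeClass_eq_zero_iff hP0]
      rfl
    simp only [mem_lineModule, hclass]
    constructor
    · intro hv
      obtain ⟨r, hr⟩ := hcspan ⟨_, hv⟩
      obtain ⟨s, rfl⟩ := Ideal.Quotient.mk_surjective r
      exact ⟨s, (congrArg Subtype.val hr).symm⟩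
    · rintro ⟨s, hs⟩
      exact hs ▸ C.smul_mem _ hcC
  rw [mem_codeLattice, Submodule.mem_map]
  constructor
  · rintro ⟨v, hv, rfl⟩
    exact ⟨v, (hline v).mp hv, rfl⟩
  · rintro ⟨v, hv, rfl⟩
    exact ⟨⟨v, lineModule_le_baseModule w.2 hv⟩, (hline _).mpr hv, rfl⟩

theorem exists_mem_polarIdeal_notMem_codifferent (hP : P.IsMaximal) :
    ∃ b ∈ polarIdeal P, b ∉ codifferent K := by
  have hP0 := ne_bot_of_isMaximal hP
  by_contra! hcon
  have hmul : (P : FractionalIdeal (nonZeroDivisors (𝓞 K)) K) * polarIdeal P =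
      1 * polarIdeal P := by
    rw [one_mul]
    refine le_antisymm ?_ ((show polarIdeal P ≤ codifferent K from hcon).trans_eq
      (mul_polarIdeal hP0).symm)
    exact (mul_le_mul_left coeIdeal_le_one (polarIdeal P)).trans_eq (one_mul _)
  have hone := mul_right_cancel₀ (polarIdeal_ne_zero hP0) hmul
  rw [coeIdeal_eq_one] at hone
  exact hP.ne_top (hone.trans Ideal.one_eq_top)

theorem finrank_codeSpace (hP : P.IsMaximal) : finrank (𝓞 K ⧸ P) (CodeSpace P) = 2 := by
  let _ := Ideal.Quotient.field P
  have hP0 := ne_bot_of_isMaximal hP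
  obtain ⟨j, hj, hjD⟩ := exists_mem_polarIdeal_notMem_codifferent hP
  let e₁ := codeClass P ⟨(1, 0), one_mem_one _, Submodule.zero_mem _⟩
  let e₂ := codeClass P ⟨(0, j), Submodule.zero_mem _, hj⟩
  have hcomb (s t : 𝓞 K) (v : baseModule P) :
      codeClass P v = Ideal.Quotient.mk P s • e₁ + Ideal.Quotient.mk P t • e₂ ↔
        (v : K × K).1 - algebraMap _ K s ∈ (P : FractionalIdeal (nonZeroDivisors (𝓞 K)) K) ∧
          (v : K × K).2 - t • j ∈ codifferent K := by
    rw [mk_smul_codeClass, mk_smul_codeClass, ← map_add, ← sub_eq_zero, ← map_sub,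
      codeClass_eq_zero_iff hP0, mem_smul_baseModule hP0]
    simp [Algebra.smul_def]
  have hindep : LinearIndependent (𝓞 K ⧸ P) ![e₁, e₂] := by
    refine LinearIndependent.pair_iff.mpr fun r t hrt => ?_
    obtain ⟨r, rfl⟩ := Ideal.Quotient.mk_surjective r
    obtain ⟨t, rfl⟩ := Ideal.Quotient.mk_surjective t
    obtain ⟨hr, ht⟩ := (hcomb r t 0).mp (by rw [map_zero, hrt])
    simp only [ZeroMemClass.coe_zero, Prod.fst_zero, Prod.snd_zero, zero_sub] at hr ht
    rw [← mem_coe, neg_mem_iff, mem_coe] at hr ht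
    rw [algebraMap_mem_coeIdeal_iff] at hr
    rw [Algebra.smul_def] at ht
    have ht' := (mem_or_mem_codifferent_of_mul_mem hP ((mem_one_iff _).mpr ⟨t, rfl⟩) hj
      ht).resolve_right hjD
    rw [algebraMap_mem_coeIdeal_iff] at ht'
    exact ⟨Ideal.Quotient.eq_zero_iff_mem.mpr hr, Ideal.Quotient.eq_zero_iff_mem.mpr ht'⟩
  have hspan : ⊤ ≤ Submodule.span (𝓞 K ⧸ P) (Set.range ![e₁, e₂]) := by
    rintro c -
    obtain ⟨v, rfl⟩ := codeClass_surjective c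
    obtain ⟨s, hs⟩ := (mem_one_iff _).mp v.2.1
    obtain ⟨t, ht⟩ := exists_sub_smul_mem_of_notMem hP hj (by rwa [mul_polarIdeal hP0]) v.2.2
    rw [mul_polarIdeal hP0] at ht
    rw [(hcomb s t v).mpr ⟨by rw [hs, sub_self]; exact Submodule.zero_mem _, ht⟩]
    exact Submodule.add_mem _ (Submodule.smul_mem _ _ (Submodule.subset_span ⟨0, rfl⟩))
      (Submodule.smul_mem _ _ (Submodule.subset_span ⟨1, rfl⟩))
  rw [finrank_eq_card_basis (Basis.mk hindep hspan), Fintype.card_fin]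

end Plane

section Symplectic

open Module FractionalIdeal

variable {K : Type*} [Field K] [NumberField K]

theorem span_toMinkowski_fractionalIdeal {I : FractionalIdeal (nonZeroDivisors (𝓞 K)) K}
    (hI : I ≠ 0) : Submodule.span ℝ (toMinkowski K '' (I : Set K)) = ⊤ := by
  rw [eq_top_iff, ← span_range_toMinkowski_basis
    (NumberField.basisOfFractionalIdeal K (Units.mk0 I hI))]
  refine Submodule.span_mono ?_
  rintro _ ⟨i, rfl⟩
  refine ⟨_, ?_, rfl⟩
  rw [NumberField.basisOfFractionalIdeal_apply]
  exact (NumberField.fractionalIdealBasis K _ i).2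

theorem span_planeMap_image {α : ℝ} (hα : α ≠ 0) {s t : Set K} {U : Set (K × K)}
    (hs : Submodule.span ℝ (toMinkowski K '' s) = ⊤)
    (ht : Submodule.span ℝ (toMinkowski K '' t) = ⊤) (hsU : ∀ a ∈ s, (a, 0) ∈ U)
    (htU : ∀ b ∈ t, (0, b) ∈ U) : Submodule.span ℝ (planeMap α '' U) = ⊤ := by
  set V := Submodule.span ℝ (planeMap α '' U)
  let toPlane := (WithLp.linearEquiv 2 ℝ (MinkowskiSpace K × MinkowskiSpace K)).symm.toLinearMap
  have hfst : ⊤ ≤ V.comap (toPlane ∘ₗ LinearMap.inl ℝ _ _) := by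
    rw [← hs, Submodule.span_le]
    rintro _ ⟨a, ha, rfl⟩
    have hmap : toPlane (toMinkowski K a, 0) = α • planeMap α (a, 0) := by
      refine (WithLp.equiv 2 _).injective (Prod.ext ?_ ?_) <;> simp [toPlane, planeMap, hα]
    change toPlane (toMinkowski K a, 0) ∈ V
    rw [hmap]
    exact V.smul_mem _ (Submodule.subset_span ⟨_, hsU a ha, rfl⟩)
  have hsnd : ⊤ ≤ V.comap (toPlane ∘ₗ LinearMap.inr ℝ _ _) := by
    rw [← ht, Submodule.span_le]
    rintro _ ⟨b, hb, rfl⟩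
    have hmap : toPlane (0, toMinkowski K b) = α⁻¹ • planeMap α (0, b) := by
      refine (WithLp.equiv 2 _).injective (Prod.ext ?_ ?_) <;> simp [toPlane, planeMap, hα]
    change toPlane (0, toMinkowski K b) ∈ V
    rw [hmap]
    exact V.smul_mem _ (Submodule.subset_span ⟨_, htU b hb, rfl⟩)
  refine eq_top_iff.mpr fun x _ => ?_
  have hsum : x = toPlane (x.fst, 0) + toPlane (0, x.snd) := by
    refine (WithLp.equiv 2 _).injective (Prod.ext ?_ ?_) <;> simp [toPlane]
  rw [hsum]
  exact V.add_mem (hfst trivial) (hsnd trivial)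

variable {P : Ideal (𝓞 K)}

theorem span_planeMap_smul_baseModule (hP0 : P ≠ ⊥) : Submodule.span ℝ
    (planeMap (scalingFactor P) '' ((P • baseModule P : Submodule (𝓞 K) (K × K)) : Set (K × K))) =
      ⊤ := by
  rw [smul_baseModule hP0]
  exact span_planeMap_image (scalingFactor_pos hP0).ne'
    (span_toMinkowski_fractionalIdeal (coeIdeal_ne_zero.mpr hP0))
    (span_toMinkowski_fractionalIdeal codifferent_ne_zero)
    (fun _ ha => ⟨ha, Submodule.zero_mem _⟩) fun _ hb => ⟨Submodule.zero_mem _, hb⟩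

theorem exists_int_inner_planeRotation_planeMap {α : ℝ} (hα : α ≠ 0) {v w : K × K}
    (h : planeDet v w ∈ codifferent K) :
    ∃ k : ℤ, inner ℝ (planeRotation K (planeMap α v)) (planeMap α w) = k := by
  obtain ⟨k, hk⟩ := mem_codifferent.mp h 1
  rw [one_smul] at hk
  exact ⟨k, by rw [inner_planeRotation_planeMap hα, hk, Rat.cast_intCast]⟩

theorem discreteTopology_baseLattice (hP0 : P ≠ ⊥) :
    DiscreteTopology ((baseLattice P).restrictScalars ℤ) := by
  let L : Submodule ℤ (MinkowskiPlane K) :=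
    (((P • baseModule P).map (planeMap (scalingFactor P))).restrictScalars ℤ).map
      ((planeRotation K).toLinearEquiv.toLinearMap.restrictScalars ℤ)
  have hspan : Submodule.span ℝ (L : Set (MinkowskiPlane K)) = ⊤ := by
    change Submodule.span ℝ ((planeRotation K).toLinearEquiv.toLinearMap ''
      (planeMap (scalingFactor P) '' _)) = ⊤
    rw [Submodule.span_image, span_planeMap_smul_baseModule hP0, Submodule.map_top,
      LinearEquiv.range]
  refine DiscreteTopology.of_subset (discreteTopology_dualLattice hspan) ?_
  rintro x hx _ ⟨_, ⟨w, hw, rfl⟩, rfl⟩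
  rw [SetLike.mem_coe, Submodule.restrictScalars_mem, baseLattice_eq_map] at hx
  obtain ⟨v, hv, rfl⟩ := hx
  rw [real_inner_comm]
  refine exists_int_inner_planeRotation_planeMap (scalingFactor_pos hP0).ne' ?_
  rw [planeDet_swap]
  exact Submodule.neg_mem _ (planeDet_mem_codifferent hP0 hv hw)

theorem codeLattice_le_baseLattice (C : Submodule (𝓞 K ⧸ P) (CodeSpace P)) :
    codeLattice P C ≤ (baseLattice P).restrictScalars ℤ := by
  rintro _ ⟨x, -, rfl⟩
  exact x.2

theorem planeMap_mem_codeLattice_of_mem_smul (hP0 : P ≠ ⊥)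
    (C : Submodule (𝓞 K ⧸ P) (CodeSpace P)) {v : K × K} (hv : v ∈ P • baseModule P) :
    planeMap (scalingFactor P) v ∈ codeLattice P C := by
  refine mem_codeLattice.mpr ⟨⟨v, Submodule.smul_le_right hv⟩, ?_, rfl⟩
  rw [(codeClass_eq_zero_iff hP0).mpr hv]
  exact C.zero_mem

theorem isEuclideanLattice_codeLattice (hP0 : P ≠ ⊥) (C : Submodule (𝓞 K ⧸ P) (CodeSpace P)) :
    IsEuclideanLattice (codeLattice P C) := by
  refine ⟨DiscreteTopology.of_subset (discreteTopology_baseLattice hP0)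
    (codeLattice_le_baseLattice C), ?_⟩
  rw [eq_top_iff, ← span_planeMap_smul_baseModule hP0]
  refine Submodule.span_mono ?_
  rintro _ ⟨v, hv, rfl⟩
  exact planeMap_mem_codeLattice_of_mem_smul hP0 C hv

theorem exists_mem_baseModule_eq_planeMap (hP0 : P ≠ ⊥) {α : ℝ} (hα : α ≠ 0)
    {u : MinkowskiPlane K} (hu : ∀ v ∈ P • baseModule P,
      ∃ k : ℤ, inner ℝ (planeRotation K u) (planeMap α v) = k) :
    ∃ v ∈ baseModule P, u = planeMap α v := by
  have hpair (v) (hv : v ∈ P • baseModule P) : ∃ k : ℤ,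
      ∑ φ, ((α • u.fst).coord φ * φ v.2 - (α⁻¹ • u.snd).coord φ * φ v.1) = k := by
    obtain ⟨k, hk⟩ := hu v hv
    refine ⟨k, ?_⟩
    rw [← Complex.ofReal_intCast, ← hk, inner_planeRotation]
    refine Finset.sum_congr rfl fun φ _ => ?_
    simp only [planeMap_fst, planeMap_snd, MinkowskiSpace.coord_smul, toMinkowski_coord]
    ring
  obtain ⟨a, ha, hfst⟩ := exists_eq_toMinkowski_of_integral_pairing codifferent_ne_zero
    (α • u.fst) fun d hd => by
      simpa using hpair (0, d) ((mem_smul_baseModule hP0).mpr ⟨Submodule.zero_mem _, hd⟩)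
  obtain ⟨b, hb, hsnd⟩ := exists_eq_toMinkowski_of_integral_pairing (coeIdeal_ne_zero.mpr hP0)
    (-(α⁻¹ • u.snd)) fun c hc => by
      simpa [MinkowskiSpace.coord_neg] using
        hpair (c, 0) ((mem_smul_baseModule hP0).mpr ⟨hc, Submodule.zero_mem _⟩)
  rw [dual_dual] at ha
  rw [dual_eq_mul_inv, mul_comm] at hb
  refine ⟨(a, -b), ⟨ha, Submodule.neg_mem _ hb⟩, (WithLp.equiv 2 _).injective (Prod.ext ?_ ?_)⟩
  · change u.fst = α⁻¹ • toMinkowski K a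
    rw [← hfst, inv_smul_smul₀ hα]
  · change u.snd = α • toMinkowski K (-b)
    rw [map_neg, ← hsnd, neg_neg, smul_inv_smul₀ hα]

theorem image_planeRotation_codeLattice (hP : P.IsMaximal)
    {C : Submodule (𝓞 K ⧸ P) (CodeSpace P)} (hC : finrank (𝓞 K ⧸ P) C = 1) :
    planeRotation K '' (codeLattice P C : Set (MinkowskiPlane K)) =
      (dualLattice (codeLattice P C) : Set (MinkowskiPlane K)) := by
  have hP0 := ne_bot_of_isMaximal hP
  have hα := (scalingFactor_pos hP0).ne'
  obtain ⟨w, hw, hwP, hmem⟩ := exists_mem_codeLattice_iff hP hC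
  refine Set.Subset.antisymm ?_ fun x hx => ?_
  · rintro _ ⟨x, hx, rfl⟩ y hy
    obtain ⟨v, hv, rfl⟩ := (hmem x).mp hx
    obtain ⟨u, hu, rfl⟩ := (hmem y).mp hy
    exact exists_int_inner_planeRotation_planeMap hα
      (planeDet_mem_codifferent_of_mem_lineModule hP0 hw hv hu)
  · obtain ⟨u, rfl⟩ := (planeRotation K).surjective x
    obtain ⟨v, hv, rfl⟩ := exists_mem_baseModule_eq_planeMap hP0 hα fun v hv =>
      hx _ (planeMap_mem_codeLattice_of_mem_smul hP0 C hv)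
    have hdet : planeDet v w ∈ codifferent K := mem_codifferent.mpr fun s => by
      obtain ⟨k, hk⟩ := hx _ ((hmem _).mpr (Submodule.mem_map_of_mem
        (Submodule.mem_sup_left (Submodule.smul_mem _ s (Submodule.mem_span_singleton_self w)))))
      rw [inner_planeRotation_planeMap hα, planeDet_smul_right] at hk
      exact ⟨k, mod_cast hk⟩
    exact ⟨_, (hmem _).mpr (Submodule.mem_map_of_mem (mem_lineModule.mpr
      (exists_sub_smul_mem_of_planeDet_mem hP hv hw hwP hdet))), rfl⟩

theorem isSymplecticLattice_codeLattice (hP : P.IsMaximal)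
    {C : Submodule (𝓞 K ⧸ P) (CodeSpace P)} (hC : finrank (𝓞 K ⧸ P) C = 1) :
    IsSymplecticLattice (codeLattice P C) :=
  ⟨isEuclideanLattice_codeLattice (ne_bot_of_isMaximal hP) C, planeRotation K,
    image_planeRotation_codeLattice hP hC, planeRotation_planeRotation⟩

theorem covolume_codeLattice (hP : P.IsMaximal) {C : Submodule (𝓞 K ⧸ P) (CodeSpace P)}
    (hC : finrank (𝓞 K ⧸ P) C = 1) : ZLattice.covolume (codeLattice P C) = 1 := by
  obtain ⟨_, hspan⟩ := isEuclideanLattice_codeLattice (ne_bot_of_isMaximal hP) C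
  have : IsZLattice ℝ (codeLattice P C) := ⟨hspan⟩
  exact covolume_eq_one_of_image_eq_dualLattice _ _ (image_planeRotation_codeLattice hP hC)

end Symplectic

section Counting

open Module FractionalIdeal

variable {K : Type*} [Field K] [NumberField K] {P : Ideal (𝓞 K)}

theorem card_lines (hP : P.IsMaximal) :
    Nat.card {C : Submodule (𝓞 K ⧸ P) (CodeSpace P) // finrank (𝓞 K ⧸ P) C = 1} =
      Nat.card (𝓞 K ⧸ P) + 1 := by
  let _ := Ideal.Quotient.field P
  have := Ideal.finiteQuotientOfFreeOfNeBot P (ne_bot_of_isMaximal hP)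
  rw [← Projectivization.card_of_finrank_two (𝓞 K ⧸ P) (CodeSpace P) (finrank_codeSpace hP)]
  exact Nat.card_congr (Projectivization.equivSubmodule (𝓞 K ⧸ P) (CodeSpace P)).symm

theorem index_line (hP : P.IsMaximal) {C : Submodule (𝓞 K ⧸ P) (CodeSpace P)}
    (hC : finrank (𝓞 K ⧸ P) C = 1) : C.toAddSubgroup.index = Nat.card (𝓞 K ⧸ P) := by
  let _ := Ideal.Quotient.field P
  have := Ideal.finiteQuotientOfFreeOfNeBot P (ne_bot_of_isMaximal hP)
  have hspace := finrank_codeSpace hP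
  have : Module.Finite (𝓞 K ⧸ P) (CodeSpace P) := Module.finite_of_finrank_pos (by lia)
  have hcardLine : Nat.card C.toAddSubgroup = Nat.card (𝓞 K ⧸ P) :=
    (Module.natCard_eq_pow_finrank (K := 𝓞 K ⧸ P) (V := C)).trans (by rw [hC, pow_one])
  have hcardSpace : Nat.card (CodeSpace P) = Nat.card (𝓞 K ⧸ P) ^ 2 := by
    rw [Module.natCard_eq_pow_finrank (K := 𝓞 K ⧸ P), hspace]
  have hindex := AddSubgroup.card_mul_index C.toAddSubgroup
  rw [hcardLine, hcardSpace, sq] at hindex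
  exact Nat.eq_of_mul_eq_mul_left Nat.card_pos hindex

theorem relIndex_codeLattice (hP : P.IsMaximal) {C : Submodule (𝓞 K ⧸ P) (CodeSpace P)}
    (hC : finrank (𝓞 K ⧸ P) C = 1) :
    (codeLattice P C).toAddSubgroup.relIndex ((baseLattice P).restrictScalars ℤ).toAddSubgroup =
      Nat.card (𝓞 K ⧸ P) := by
  let π := (Submodule.mkQ (P • ⊤ : Submodule (𝓞 K) (baseLattice P))).toAddMonoidHom
  have hcomap : (codeLattice P C).toAddSubgroup.addSubgroupOf
      ((baseLattice P).restrictScalars ℤ).toAddSubgroup = C.toAddSubgroup.comap π := by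
    ext x
    constructor
    · rintro ⟨y, hy, hyx⟩
      obtain rfl : y = x := Subtype.ext hyx
      exact hy
    · exact fun hx => ⟨x, hx, rfl⟩
  have hindex : (C.toAddSubgroup.comap π).index = C.toAddSubgroup.index :=
    AddSubgroup.index_comap_of_surjective _ (Submodule.mkQ_surjective _)
  rw [AddSubgroup.relIndex, hcomap]
  exact hindex.trans (index_line hP hC)

theorem isZLattice_baseLattice (hP0 : P ≠ ⊥)
    [DiscreteTopology ((baseLattice P).restrictScalars ℤ)] :
    IsZLattice ℝ ((baseLattice P).restrictScalars ℤ) :=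
  ⟨top_le_iff.mp ((isEuclideanLattice_codeLattice hP0 ⊥).2.ge.trans
    (Submodule.span_mono (codeLattice_le_baseLattice ⊥)))⟩

theorem covolume_baseLattice (hP : P.IsMaximal) :
    ZLattice.covolume ((baseLattice P).restrictScalars ℤ) = (Nat.card (𝓞 K ⧸ P) : ℝ)⁻¹ := by
  have hP0 := ne_bot_of_isMaximal hP
  have hlines := card_lines hP
  obtain ⟨C, hC⟩ := (Nat.card_pos_iff.mp (hlines.ge.trans' (Nat.succ_pos _))).1
  obtain ⟨_, hspan⟩ := isEuclideanLattice_codeLattice hP0 C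
  have : IsZLattice ℝ (codeLattice P C) := ⟨hspan⟩
  have := discreteTopology_baseLattice hP0
  have := isZLattice_baseLattice hP0
  have hquot := ZLattice.covolume_div_covolume_eq_relIndex' (codeLattice P C)
    ((baseLattice P).restrictScalars ℤ) (codeLattice_le_baseLattice C)
  rw [covolume_codeLattice hP hC, relIndex_codeLattice hP hC, one_div] at hquot
  rw [← hquot, inv_inv]

theorem exists_eq_planeMap_of_mem_codeLattice_of_ne (hP : P.IsMaximal)
    {C C' : Submodule (𝓞 K ⧸ P) (CodeSpace P)} (hC : finrank (𝓞 K ⧸ P) C = 1)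
    (hC' : finrank (𝓞 K ⧸ P) C' = 1) (hne : C ≠ C') {x : MinkowskiPlane K}
    (hx : x ∈ codeLattice P C) (hx' : x ∈ codeLattice P C') :
    ∃ v ∈ P • baseModule P, planeMap (scalingFactor P) v = x := by
  let _ := Ideal.Quotient.field P
  have hP0 := ne_bot_of_isMaximal hP
  obtain ⟨v, hv, rfl⟩ := mem_codeLattice.mp hx
  obtain ⟨v', hv', heq⟩ := mem_codeLattice.mp hx'
  obtain rfl : v' = v := Subtype.ext (planeMap_injective (scalingFactor_pos hP0).ne' heq)
  refine ⟨v', (codeClass_eq_zero_iff hP0).mp (by_contra fun hv0 => hne ?_), rfl⟩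
  have hspan {D : Submodule (𝓞 K ⧸ P) (CodeSpace P)} (hD : finrank (𝓞 K ⧸ P) D = 1)
      (hvD : codeClass P v' ∈ D) : Submodule.span (𝓞 K ⧸ P) {codeClass P v'} = D := by
    have : Module.Finite (𝓞 K ⧸ P) D := Module.finite_of_finrank_pos (by lia)
    exact Submodule.eq_of_le_of_finrank_eq ((Submodule.span_singleton_le_iff_mem _ _).mpr hvD)
      ((finrank_span_singleton hv0).trans hD.symm)
  exact (hspan hC hv).symm.trans (hspan hC' hv')

theorem norm_planeMap_smul {s : 𝓞 K} (hs : ∀ φ : K →+* ℂ, ‖φ s‖ = 1) (α : ℝ) (v : K × K) :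
    ‖planeMap α (s • v)‖ = ‖planeMap α v‖ := by
  have hnorm (a : K) : ‖toMinkowski K (s • a)‖ ^ 2 = ‖toMinkowski K a‖ ^ 2 := by
    simp only [norm_sq_toMinkowski, Algebra.smul_def, map_mul, norm_mul, hs, one_mul]
  rw [← sq_eq_sq₀ (norm_nonneg _) (norm_nonneg _), norm_sq_planeMap, norm_sq_planeMap,
    Prod.smul_fst, Prod.smul_snd, hnorm, hnorm]

theorem norm_planeMap_pow_smul {s : 𝓞 K} (hs : ∀ φ : K →+* ℂ, ‖φ s‖ = 1) (i : ℕ) (α : ℝ)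
    (v : K × K) : ‖planeMap α (s ^ i • v)‖ = ‖planeMap α v‖ :=
  norm_planeMap_smul (fun φ => by
    have hpow : ((s ^ i : 𝓞 K) : K) = (s : K) ^ i := map_pow (algebraMap (𝓞 K) K) s i
    rw [hpow, map_pow, norm_pow, hs, one_pow]) α v

omit [NumberField K] in
theorem norm_embedding_eq_one_of_isPrimitiveRoot {m : ℕ} [NeZero m] {ζ : 𝓞 K}
    (hζ : IsPrimitiveRoot ζ m) (φ : K →+* ℂ) : ‖φ ζ‖ = 1 :=
  Complex.norm_eq_one_of_pow_eq_one
    (by rw [← map_pow, ← map_pow, hζ.pow_eq_one, map_one, map_one]) (NeZero.ne m)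

theorem exists_finset_codeLattice_card_eq (hP0 : P ≠ ⊥) {m : ℕ} [NeZero m] {ζ : 𝓞 K}
    (hζ : IsPrimitiveRoot ζ m) {C : Submodule (𝓞 K ⧸ P) (CodeSpace P)} {x : MinkowskiPlane K}
    (hx : x ∈ codeLattice P C) (hx0 : x ≠ 0) :
    ∃ X : Finset (MinkowskiPlane K), X.card = m ∧
      ∀ y ∈ X, y ∈ codeLattice P C ∧ y ≠ 0 ∧ ‖y‖ = ‖x‖ := by
  classical
  obtain ⟨v, hv, rfl⟩ := mem_codeLattice.mp hx
  have hinj := planeMap_injective (K := K) (scalingFactor_pos hP0).ne'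
  have hv0 : (v : K × K) ≠ 0 := fun h => hx0 (by rw [h, map_zero])
  refine ⟨(Finset.range m).image fun i => planeMap (scalingFactor P) (ζ ^ i • (v : K × K)),
    ?_, fun y hy => ?_⟩
  · rw [Finset.card_image_of_injOn, Finset.card_range]
    intro i hi j hj hij
    exact hζ.pow_inj (Finset.mem_range.mp hi) (Finset.mem_range.mp hj)
      (smul_left_injective _ hv0 (hinj hij))
  · obtain ⟨i, -, rfl⟩ := Finset.mem_image.mp hy
    refine ⟨mem_codeLattice.mpr ⟨ζ ^ i • v, ?_, rfl⟩, ?_,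
      norm_planeMap_pow_smul (norm_embedding_eq_one_of_isPrimitiveRoot hζ) i _ _⟩
    · rw [← mk_smul_codeClass]
      exact C.smul_mem _ hv
    · rw [map_ne_zero_iff _ hinj]
      exact smul_ne_zero ((hζ.isUnit (NeZero.ne m)).pow i).ne_zero hv0

theorem exists_finset_baseLattice_card_eq (hP : P.IsMaximal) {m : ℕ} [NeZero m] {ζ : 𝓞 K}
    (hζ : IsPrimitiveRoot ζ m) {r : ℝ}
    (hlong : ∀ v ∈ P • baseModule P, v ≠ 0 → r ≤ ‖planeMap (scalingFactor P) v‖)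
    (hshort : ∀ C : Submodule (𝓞 K ⧸ P) (CodeSpace P), finrank (𝓞 K ⧸ P) C = 1 →
      ∃ x ∈ codeLattice P C, x ≠ 0 ∧ ‖x‖ < r) :
    ∃ X : Finset (MinkowskiPlane K), X.card = (Nat.card (𝓞 K ⧸ P) + 1) * m ∧
      ∀ x ∈ X, x ∈ baseLattice P ∧ ‖x‖ < r := by
  classical
  let Line := {C : Submodule (𝓞 K ⧸ P) (CodeSpace P) // finrank (𝓞 K ⧸ P) C = 1}
  have hcard : Nat.card Line = Nat.card (𝓞 K ⧸ P) + 1 := card_lines hP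
  have : Finite Line := Nat.finite_of_card_ne_zero (by lia)
  have := Fintype.ofFinite Line
  have horbit (C : Line) : ∃ X : Finset (MinkowskiPlane K), X.card = m ∧
      ∀ y ∈ X, y ∈ codeLattice P C.1 ∧ y ≠ 0 ∧ ‖y‖ < r := by
    obtain ⟨x, hx, hx0, hxr⟩ := hshort C.1 C.2
    obtain ⟨X, hXm, hX⟩ := exists_finset_codeLattice_card_eq (ne_bot_of_isMaximal hP) hζ hx hx0
    exact ⟨X, hXm, fun y hy => ⟨(hX y hy).1, (hX y hy).2.1, (hX y hy).2.2.trans_lt hxr⟩⟩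
  choose X hXm hX using horbit
  have hdisj (C C' : Line) (hne : C ≠ C') : Disjoint (X C) (X C') := by
    refine Finset.disjoint_left.mpr fun y hy hy' => ?_
    obtain ⟨hyC, hy0, hyr⟩ := hX C y hy
    obtain ⟨v, hv, rfl⟩ := exists_eq_planeMap_of_mem_codeLattice_of_ne hP C.2 C'.2
      (fun h => hne (Subtype.ext h)) hyC (hX C' y hy').1
    exact (hlong v hv (fun h => hy0 (by rw [h, map_zero]))).not_gt hyr
  refine ⟨Finset.univ.biUnion X, ?_, fun x hx => ?_⟩
  · rw [Finset.card_biUnion fun C _ C' _ => hdisj C C', Finset.sum_congr rfl fun C _ => hXm C,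
      Finset.sum_const, Finset.card_univ, ← Nat.card_eq_fintype_card, hcard, smul_eq_mul]
  · obtain ⟨C, -, hx⟩ := Finset.mem_biUnion.mp hx
    exact ⟨codeLattice_le_baseLattice C.1 (hX C x hx).1, (hX C x hx).2.2⟩

end Counting

/-! ### Short vectors -/

section ShortVectors

open Module FractionalIdeal NumberField InfinitePlace

variable {K : Type*} [Field K] [NumberField K] {P : Ideal (𝓞 K)}
  {I : FractionalIdeal (nonZeroDivisors (𝓞 K)) K} {x : K}

theorem absNorm_le_abs_norm (hx : x ∈ I) (hx0 : x ≠ 0) : absNorm I ≤ |Algebra.norm ℚ x| := by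
  have hI : I ≠ 0 := by
    rintro rfl
    exact hx0 ((mem_zero_iff _).mp hx)
  have hle : spanSingleton (nonZeroDivisors (𝓞 K)) x * I⁻¹ ≤ 1 :=
    (mul_le_mul_left (spanSingleton_le_iff_mem.mpr hx) I⁻¹).trans_eq (mul_inv_cancel₀ hI)
  obtain ⟨A, hA⟩ := le_one_iff_exists_coeIdeal.mp hle
  have hspan : spanSingleton (nonZeroDivisors (𝓞 K)) x = A * I := by
    rw [hA, mul_assoc, inv_mul_cancel₀ hI, mul_one]
  have hnorm : |Algebra.norm ℚ x| = Ideal.absNorm A * absNorm I := by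
    rw [← absNorm_span_singleton (R := 𝓞 K), hspan, map_mul, coeIdeal_absNorm]
  have hA0 : Ideal.absNorm A ≠ 0 := fun h0 => by
    rw [h0, Nat.cast_zero, zero_mul, abs_eq_zero, Algebra.norm_eq_zero_iff] at hnorm
    exact hx0 hnorm
  rw [hnorm]
  exact le_mul_of_one_le_left (absNorm_nonneg I) (mod_cast Nat.one_le_iff_ne_zero.mpr hA0)

theorem absNorm_codifferent : absNorm (codifferent K) = |(discr K : ℚ)|⁻¹ := by
  have hdifferent : (differentIdeal ℤ (𝓞 K) : FractionalIdeal (nonZeroDivisors (𝓞 K)) K) =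
      (codifferent K)⁻¹ := coeIdeal_differentIdeal ℤ ℚ K (𝓞 K)
  have hinv : absNorm (codifferent K)⁻¹ = |(discr K : ℚ)| := by
    rw [← hdifferent, coeIdeal_absNorm, absNorm_differentIdeal K, Nat.cast_natAbs, Int.cast_abs]
  rw [← hinv, map_inv₀, inv_inv]

theorem absNorm_coeIdeal_eq_card :
    absNorm (P : FractionalIdeal (nonZeroDivisors (𝓞 K)) K) = Nat.card (𝓞 K ⧸ P) := by
  rw [coeIdeal_absNorm, Ideal.absNorm_apply, Submodule.cardQuot_apply]

theorem one_le_abs_discr : 1 ≤ |(discr K : ℝ)| :=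
  mod_cast Int.one_le_abs (discr_ne_zero K)

theorem abs_norm_sq_le_norm_sq_toMinkowski_div_pow (x : K) :
    (|Algebra.norm ℚ x| : ℝ) ^ 2 ≤ (‖toMinkowski K x‖ ^ 2 / finrank ℚ K) ^ finrank ℚ K := by
  have hn : 0 < finrank ℚ K := finrank_pos
  have hcard : (∑ _φ : K →+* ℂ, (1 : ℝ)) = finrank ℚ K := by
    rw [Finset.sum_const, Finset.card_univ, Embeddings.card K ℂ, nsmul_one]
  have hprod : ∏ φ : K →+* ℂ, ‖φ x‖ ^ 2 = (|Algebra.norm ℚ x| : ℝ) ^ 2 := by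
    have hnorm := congrArg (‖·‖) (Algebra.norm_eq_prod_embeddings ℚ ℂ x)
    rw [norm_prod, ← Fintype.prod_equiv (RingHom.equivRatAlgHom K ℂ) (fun f => ‖f x‖)
      (fun φ => ‖φ x‖) fun _ => rfl, eq_ratCast, Complex.norm_ratCast] at hnorm
    rw [Finset.prod_pow, hnorm]
  have hmean := Real.geom_mean_le_arith_mean Finset.univ (fun _ : K →+* ℂ => 1)
    (fun φ => ‖φ x‖ ^ 2) (fun _ _ => zero_le_one) (by rw [hcard]; exact_mod_cast hn)
    (fun _ _ => by positivity)
  simp only [Real.rpow_one, one_mul] at hmean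
  rw [hcard, ← norm_sq_toMinkowski, hprod] at hmean
  have hpow := pow_le_pow_left₀ (by positivity) hmean (finrank ℚ K)
  rwa [Real.rpow_inv_natCast_pow (by positivity) hn.ne'] at hpow

theorem absNorm_sq_le_norm_sq_toMinkowski_div_pow (hx : x ∈ I) (hx0 : x ≠ 0) :
    (absNorm I : ℝ) ^ 2 ≤ (‖toMinkowski K x‖ ^ 2 / finrank ℚ K) ^ finrank ℚ K := by
  refine le_trans ?_ (abs_norm_sq_le_norm_sq_toMinkowski_div_pow x)
  have hle : (absNorm I : ℝ) ≤ |(Algebra.norm ℚ x : ℝ)| := mod_cast absNorm_le_abs_norm hx hx0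
  have hnonneg : (0 : ℝ) ≤ absNorm I := mod_cast absNorm_nonneg I
  gcongr

theorem scalingFactor_sq_pow_finrank (P : Ideal (𝓞 K)) :
    (scalingFactor P ^ 2) ^ finrank ℚ K = Nat.card (𝓞 K ⧸ P) * |(discr K : ℝ)| := by
  have hn : (0 : ℝ) < finrank ℚ K := mod_cast finrank_pos
  rw [← pow_mul, scalingFactor, ← Real.rpow_natCast, ← Real.rpow_mul (by positivity), Nat.cast_mul,
    Nat.cast_two, one_div_mul_cancel (by positivity), Real.rpow_one]

theorem card_div_abs_discr_le_norm_sq_planeMap_div_pow (hP0 : P ≠ ⊥) {v : K × K}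
    (hv : v ∈ P • baseModule P) (hv0 : v ≠ 0) :
    Nat.card (𝓞 K ⧸ P) / |(discr K : ℝ)| ≤
      (‖planeMap (scalingFactor P) v‖ ^ 2 / finrank ℚ K) ^ finrank ℚ K := by
  obtain ⟨hv₁, hv₂⟩ := (mem_smul_baseModule hP0).mp hv
  have hd : 0 < |(discr K : ℝ)| := one_pos.trans_le one_le_abs_discr
  have hpow := scalingFactor_sq_pow_finrank P
  have := Ideal.finiteQuotientOfFreeOfNeBot P hP0
  have hq : (0 : ℝ) < Nat.card (𝓞 K ⧸ P) := mod_cast Nat.card_pos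
  rw [norm_sq_planeMap]
  set α := scalingFactor P
  set n := finrank ℚ K
  by_cases h₁ : v.1 = 0
  · have h₂ : v.2 ≠ 0 := fun h₂ => hv0 (Prod.ext h₁ h₂)
    have hle := absNorm_sq_le_norm_sq_toMinkowski_div_pow hv₂ h₂
    rw [absNorm_codifferent] at hle
    push_cast at hle
    calc (Nat.card (𝓞 K ⧸ P) : ℝ) / |(discr K : ℝ)|
        = (α ^ 2) ^ n * (|(discr K : ℝ)|⁻¹) ^ 2 := by rw [hpow]; field_simp
      _ ≤ (α ^ 2) ^ n * (‖toMinkowski K v.2‖ ^ 2 / n) ^ n := by gcongr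
      _ = (α ^ 2 * ‖toMinkowski K v.2‖ ^ 2 / n) ^ n := by rw [← mul_pow, mul_div_assoc]
      _ ≤ _ := by
        gcongr
        exact le_add_of_nonneg_left (by positivity)
  · have hle := absNorm_sq_le_norm_sq_toMinkowski_div_pow hv₁ h₁
    rw [absNorm_coeIdeal_eq_card, Rat.cast_natCast] at hle
    have hpow' : (α⁻¹ ^ 2) ^ n = (Nat.card (𝓞 K ⧸ P) * |(discr K : ℝ)|)⁻¹ := by
      rw [← hpow, inv_pow, inv_pow]
    calc (Nat.card (𝓞 K ⧸ P) : ℝ) / |(discr K : ℝ)|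
        = (α⁻¹ ^ 2) ^ n * (Nat.card (𝓞 K ⧸ P) : ℝ) ^ 2 := by rw [hpow']; field_simp
      _ ≤ (α⁻¹ ^ 2) ^ n * (‖toMinkowski K v.1‖ ^ 2 / n) ^ n := by gcongr
      _ = (α⁻¹ ^ 2 * ‖toMinkowski K v.1‖ ^ 2 / n) ^ n := by rw [← mul_pow, mul_div_assoc]
      _ ≤ _ := by
        gcongr
        exact le_add_of_nonneg_right (by positivity)

theorem norm_sq_toMinkowski_one : ‖toMinkowski K (1 : K)‖ ^ 2 = finrank ℚ K := by
  simp only [norm_sq_toMinkowski, map_one, norm_one, one_pow, Finset.sum_const, Finset.card_univ,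
    Embeddings.card K ℂ, nsmul_one]

theorem inv_scalingFactor_sq_le (hP0 : P ≠ ⊥) : (scalingFactor P)⁻¹ ^ 2 ≤
    ((Nat.card (𝓞 K ⧸ P) : ℝ) ^ (1 / (finrank ℚ K : ℝ)))⁻¹ := by
  have hn : 0 < finrank ℚ K := finrank_pos
  have := Ideal.finiteQuotientOfFreeOfNeBot P hP0
  have hq : (0 : ℝ) < Nat.card (𝓞 K ⧸ P) := mod_cast Nat.card_pos
  rw [inv_pow]
  refine inv_anti₀ (by positivity) (le_of_pow_le_pow_left₀ hn.ne' (by positivity) ?_)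
  rw [scalingFactor_sq_pow_finrank, one_div, Real.rpow_inv_natCast_pow hq.le hn.ne']
  exact le_mul_of_one_le_right hq.le one_le_abs_discr

theorem inv_two_pow_lt_two_pow_mul_pi_pow : (2⁻¹ : ℝ) ^ nrComplexPlaces K <
    2 ^ nrRealPlaces K * Real.pi ^ nrComplexPlaces K := by
  have hplaces : nrRealPlaces K + nrComplexPlaces K ≠ 0 := by
    have := card_add_two_mul_card_eq_rank K
    have : 0 < finrank ℚ K := finrank_pos
    lia
  rw [inv_pow, inv_lt_iff_one_lt_mul₀ (by positivity)]
  calc (1 : ℝ) < 2 ^ (nrRealPlaces K + nrComplexPlaces K) := one_lt_pow₀ one_lt_two hplaces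
    _ = 2 ^ nrRealPlaces K * 1 ^ nrComplexPlaces K * 2 ^ nrComplexPlaces K := by
      rw [one_pow, mul_one, pow_add]
    _ ≤ _ := by
      gcongr
      exact one_le_two.trans Real.two_le_pi

open mixedEmbedding in
theorem exists_ne_zero_mem_forall_norm_lt (hI : I ≠ 0) {t : ℝ} (ht : 0 ≤ t)
    (hle : 2 ^ finrank ℚ K * absNorm I * √|(discr K : ℝ)| ≤ t ^ finrank ℚ K) :
    ∃ y ∈ I, y ≠ 0 ∧ ∀ φ : K →+* ℂ, ‖φ y‖ < t := by
  classical
  have hnorm : (0 : ℝ) < absNorm I :=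
    mod_cast (absNorm_nonneg I).lt_of_ne' (absNorm_eq_zero_iff.not.mpr hI)
  have hd : 0 < |(discr K : ℝ)| := one_pos.trans_le one_le_abs_discr
  obtain ⟨y, hy, hy0, hlt⟩ := exists_ne_zero_mem_ideal_lt K (f := fun _ => t.toNNReal)
    (Units.mk0 I hI) (by
      rw [minkowskiBound, volume_fundamentalDomain_fractionalIdealLatticeBasis,
        volume_fundamentalDomain_latticeBasis, mixedEmbedding.finrank, convexBodyLT_volume,
        Finset.prod_pow_eq_pow_sum, sum_mult_eq, Units.val_mk0, ENNReal.ofReal,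
        show (2⁻¹ : ENNReal) = ((2⁻¹ : NNReal) : ENNReal) by rw [ENNReal.coe_inv two_ne_zero]; rfl]
      norm_cast
      rw [← NNReal.coe_lt_coe]
      push_cast
      rw [Real.coe_toNNReal _ ht, Real.coe_toNNReal _ hnorm.le, Int.norm_eq_abs]
      calc (absNorm I : ℝ) * (2⁻¹ ^ nrComplexPlaces K * √|(discr K : ℝ)|) * 2 ^ finrank ℚ K
          = 2⁻¹ ^ nrComplexPlaces K * (2 ^ finrank ℚ K * absNorm I * √|(discr K : ℝ)|) := by ring
        _ < 2 ^ nrRealPlaces K * Real.pi ^ nrComplexPlaces K *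
            (2 ^ finrank ℚ K * absNorm I * √|(discr K : ℝ)|) := by
          gcongr
          exact inv_two_pow_lt_two_pow_mul_pi_pow
        _ ≤ 2 ^ nrRealPlaces K * Real.pi ^ nrComplexPlaces K * t ^ finrank ℚ K := by gcongr)
  refine ⟨y, hy, hy0, fun φ => ?_⟩
  simpa only [InfinitePlace.apply, Real.coe_toNNReal _ ht] using hlt (InfinitePlace.mk φ)

theorem exists_ne_zero_mem_norm_sq_toMinkowski_le (hI : I ≠ 0) {t : ℝ} (ht : 0 ≤ t)
    (hle : 2 ^ finrank ℚ K * absNorm I * √|(discr K : ℝ)| ≤ t ^ finrank ℚ K) :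
    ∃ y ∈ I, y ≠ 0 ∧ ‖toMinkowski K y‖ ^ 2 ≤ finrank ℚ K * t ^ 2 := by
  obtain ⟨y, hy, hy0, hlt⟩ := exists_ne_zero_mem_forall_norm_lt hI ht hle
  refine ⟨y, hy, hy0, ?_⟩
  calc ‖toMinkowski K y‖ ^ 2 = ∑ φ : K →+* ℂ, ‖φ y‖ ^ 2 := norm_sq_toMinkowski y
    _ ≤ ∑ _φ : K →+* ℂ, t ^ 2 := by
      gcongr with φ
      exact (hlt φ).le
    _ = finrank ℚ K * t ^ 2 := by
      rw [Finset.sum_const, Finset.card_univ, Embeddings.card K ℂ, nsmul_eq_mul]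

theorem exists_short_polarIdeal (hP0 : P ≠ ⊥) : ∃ y ∈ polarIdeal P, y ≠ 0 ∧
    scalingFactor P ^ 2 * ‖toMinkowski K y‖ ^ 2 ≤ 4 * finrank ℚ K *
      ((Nat.card (𝓞 K ⧸ P) : ℝ) ^ (1 / (finrank ℚ K : ℝ)))⁻¹ := by
  have hn : 0 < finrank ℚ K := finrank_pos
  have := Ideal.finiteQuotientOfFreeOfNeBot P hP0
  have hq : (0 : ℝ) < Nat.card (𝓞 K ⧸ P) := mod_cast Nat.card_pos
  have hd : 0 < |(discr K : ℝ)| := one_pos.trans_le one_le_abs_discr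
  have hα := scalingFactor_pos hP0
  set q : ℝ := (Nat.card (𝓞 K ⧸ P) : ℝ)
  have hnorm : (absNorm (polarIdeal P) : ℝ) = (q * |(discr K : ℝ)|)⁻¹ := by
    rw [polarIdeal, map_mul, map_inv₀, absNorm_coeIdeal_eq_card, absNorm_codifferent]
    push_cast
    rw [mul_inv]
  set β : ℝ := q ^ (1 / (finrank ℚ K : ℝ)) with hβ
  have hβpos : 0 < β := by positivity
  have hβpow : β ^ finrank ℚ K = q := by
    rw [hβ, one_div, Real.rpow_inv_natCast_pow hq.le hn.ne']
  set t : ℝ := 2 / (scalingFactor P * √β)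
  have htsq : t ^ 2 = 4 / (scalingFactor P ^ 2 * β) := by
    rw [div_pow, mul_pow, Real.sq_sqrt hβpos.le]
    norm_num
  obtain ⟨y, hy, hy0, hle⟩ := exists_ne_zero_mem_norm_sq_toMinkowski_le (polarIdeal_ne_zero hP0)
    (by positivity : 0 ≤ t) (by
      refine le_of_sq_le_sq ?_ (by positivity)
      rw [hnorm, ← pow_mul t, mul_comm _ 2, pow_mul t, htsq, div_pow, mul_pow _ β, hβpow,
        scalingFactor_sq_pow_finrank, mul_pow, mul_pow, Real.sq_sqrt hd.le, ← pow_mul,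
        mul_comm _ 2, pow_mul]
      norm_num
      change _ ≤ 4 ^ finrank ℚ K / (q * _ * q)
      field_simp
      rfl)
  refine ⟨y, hy, hy0, ?_⟩
  calc scalingFactor P ^ 2 * ‖toMinkowski K y‖ ^ 2
      ≤ scalingFactor P ^ 2 * (finrank ℚ K * t ^ 2) := by gcongr
    _ = 4 * finrank ℚ K * β⁻¹ := by
      rw [htsq]
      field_simp

end ShortVectors

section Radius

open Real

theorem div_exp_one_pow_le_factorial (k : ℕ) : (k / exp 1) ^ k ≤ (k.factorial : ℝ) := by
  have hle := pow_div_factorial_le_exp (k : ℝ) (Nat.cast_nonneg k) k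
  rw [div_pow, ← exp_nat_mul, mul_one]
  exact (div_le_comm₀ (by positivity) (exp_pos _)).mp hle

theorem exists_radius {k : ℕ} (hk : k ≠ 0) {T : ℝ} (hT : 1 ≤ T) (hTk : T ≤ 4 * (k : ℝ) ^ 2) :
    ∃ r : ℝ, 0 < r ∧ (r ^ 2) ^ k * (π ^ k / k.factorial) = T ∧ k / 9 ≤ r ^ 2 ∧
      r ^ 2 < 4 * (k : ℝ) ^ 3 := by
  have hfactorial : (0 : ℝ) < k.factorial := by positivity
  set s : ℝ := (T * k.factorial) ^ ((k : ℝ)⁻¹) / π with hs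
  have hs0 : 0 < s := by positivity
  have hpow : (s * π) ^ k = T * k.factorial := by
    rw [hs, div_mul_cancel₀ _ pi_ne_zero, rpow_inv_natCast_pow (by positivity) hk]
  refine ⟨√s, sqrt_pos.mpr hs0, ?_, ?_, ?_⟩ <;> rw [sq_sqrt hs0.le]
  · rw [← mul_div_assoc, ← mul_pow, hpow, mul_div_cancel_right₀ _ hfactorial.ne']
  · have hle : k / exp 1 ≤ s * π := by
      refine le_of_pow_le_pow_left₀ hk (by positivity) ?_
      rw [hpow]
      exact (div_exp_one_pow_le_factorial k).trans (le_mul_of_one_le_left hfactorial.le hT)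
    have hpi : π * exp 1 ≤ 9 := by nlinarith [pi_lt_d2, exp_one_lt_d9, pi_pos, exp_pos 1]
    rw [div_le_iff₀ (by norm_num)]
    calc (k : ℝ) ≤ s * π * exp 1 := (div_le_iff₀ (exp_pos 1)).mp hle
      _ = s * (π * exp 1) := mul_assoc _ _ _
      _ ≤ s * 9 := by gcongr
  · have hle : s * π ≤ T * k := by
      refine le_of_pow_le_pow_left₀ hk (by positivity) ?_
      rw [hpow, mul_pow]
      gcongr
      · exact le_self_pow₀ hT hk
      · exact_mod_cast k.factorial_le_pow
    calc s < s * π := lt_mul_of_one_lt_right hs0 (by linarith [pi_gt_three])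
      _ ≤ T * k := hle
      _ ≤ 4 * (k : ℝ) ^ 2 * k := by gcongr
      _ = 4 * (k : ℝ) ^ 3 := by ring

theorem add_sq_pow_le_sq_pow_mul_exp {r τ : ℝ} (hr : 0 < r) (hτ : 0 ≤ τ) (k : ℕ) :
    ((r + τ) ^ 2) ^ k ≤ (r ^ 2) ^ k * exp (2 * k * τ / r) := by
  have hle : r + τ ≤ r * exp (τ / r) := by
    calc r + τ = r * (τ / r + 1) := by field_simp; ring
      _ ≤ r * exp (τ / r) := by gcongr; exact add_one_le_exp _
  calc ((r + τ) ^ 2) ^ k ≤ ((r * exp (τ / r)) ^ 2) ^ k := by gcongr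
    _ = (r ^ 2) ^ k * exp (2 * k * τ / r) := by
      rw [mul_pow, mul_pow, ← exp_nat_mul, ← exp_nat_mul]
      congr 2
      push_cast
      ring

theorem two_mul_sqrt_div_le_sqrt {k : ℕ} {r Q : ℝ} (hr : 0 < r) (hrk : k / 9 ≤ r ^ 2)
    (hQ : 0 < Q) :
    2 * k * √(5 / 4 * (k : ℝ) ^ 2 * Q⁻¹) / r ≤ √(45 * (k : ℝ) ^ 3 / Q) := by
  refine le_sqrt_of_sq_le ?_
  rw [div_pow, mul_pow, sq_sqrt (by positivity), div_le_div_iff₀ (by positivity) hQ]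
  calc (2 * (k : ℝ)) ^ 2 * (5 / 4 * (k : ℝ) ^ 2 * Q⁻¹) * Q = 45 * (k : ℝ) ^ 3 * (k / 9) := by
        field_simp
        ring
    _ ≤ 45 * (k : ℝ) ^ 3 * r ^ 2 := by gcongr

end Radius

/-! ### Dense symplectic lattices -/

section CoveringRadius

open Module NumberField

variable {K : Type*} [Field K] [NumberField K] {P : Ideal (𝓞 K)}

theorem span_toMinkowski_powerBasis_smul (B : PowerBasis ℚ K) {y : K} (hy : y ≠ 0) :
    Submodule.span ℝ (toMinkowski K '' Set.range fun i : Fin B.dim => B.gen ^ (i : ℕ) * y) =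
      ⊤ := by
  let b := B.basis.map
    (LinearEquiv.ofInjectiveEndo (LinearMap.mulRight ℚ y) (mul_left_injective₀ hy))
  have hb (i) : b i = B.gen ^ (i : ℕ) * y := congrArg (· * y) (B.basis_eq_pow i)
  rw [← Set.range_comp]
  simpa only [Function.comp_def, hb] using span_range_toMinkowski_basis b

theorem exists_mem_baseLattice_norm_sub_le_of_powerBasis (B : PowerBasis ℚ K) {ζ : 𝓞 K}
    (hgen : B.gen = ζ) (hζ : ∀ φ : K →+* ℂ, ‖φ ζ‖ = 1) (hP0 : P ≠ ⊥) {y : K}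
    (hy : y ∈ polarIdeal P) (hy0 : y ≠ 0) {τ : ℝ} (hτ : 0 ≤ τ)
    (hle : finrank ℚ K * (‖planeMap (scalingFactor P) ((1, 0) : K × K)‖ ^ 2 +
      ‖planeMap (scalingFactor P) (0, y)‖ ^ 2) ≤ 4 * τ ^ 2) (x : MinkowskiPlane K) :
    ∃ z ∈ (baseLattice P).restrictScalars ℤ, ‖x - z‖ ≤ τ := by
  have hmem {v : K × K} (hv : v ∈ baseModule P) (i : ℕ) :
      planeMap (scalingFactor P) (ζ ^ i • v) ∈ baseLattice P := by
    rw [baseLattice_eq_map]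
    exact Submodule.mem_map_of_mem ((baseModule P).smul_mem _ hv)
  have hsmul (i : ℕ) (a : K) : B.gen ^ i * a = ζ ^ i • a := by
    rw [hgen, Algebra.smul_def, map_pow]
  refine exists_mem_norm_sub_le_of_sum_norm_sq_le _
    (b := Sum.elim (fun i : Fin B.dim => planeMap (scalingFactor P) (ζ ^ (i : ℕ) • (1, 0)))
      fun i : Fin B.dim => planeMap (scalingFactor P) (ζ ^ (i : ℕ) • (0, y))) ?_ ?_ hτ ?_ x
  · rintro (i | i)
    · exact hmem ⟨FractionalIdeal.one_mem_one _, Submodule.zero_mem _⟩ i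
    · exact hmem ⟨Submodule.zero_mem _, hy⟩ i
  · rw [Set.Sum.elim_range, Set.range_comp' (planeMap _), Set.range_comp' (planeMap _),
      ← Set.image_union]
    refine span_planeMap_image (scalingFactor_pos hP0).ne'
      (span_toMinkowski_powerBasis_smul B one_ne_zero) (span_toMinkowski_powerBasis_smul B hy0)
      ?_ ?_
    · rintro _ ⟨i, rfl⟩
      exact Or.inl ⟨i, Prod.ext (hsmul _ _).symm (smul_zero _)⟩
    · rintro _ ⟨i, rfl⟩
      exact Or.inr ⟨i, Prod.ext (smul_zero _) (hsmul _ _).symm⟩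
  · simpa only [Fintype.sum_sum_type, Sum.elim_inl, Sum.elim_inr, norm_planeMap_pow_smul hζ,
      Finset.sum_const, Finset.card_univ, Fintype.card_fin, nsmul_eq_mul, ← mul_add,
      ← B.finrank] using hle

theorem exists_mem_baseLattice_norm_sub_le (m : ℕ) [NeZero m] [IsCyclotomicExtension {m} ℚ K]
    (hP0 : P ≠ ⊥) {τ : ℝ} (hτ : 0 ≤ τ)
    (hle : 5 * (finrank ℚ K : ℝ) ^ 2 *
      ((Nat.card (𝓞 K ⧸ P) : ℝ) ^ (1 / (finrank ℚ K : ℝ)))⁻¹ ≤ 4 * τ ^ 2)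
    (x : MinkowskiPlane K) : ∃ z ∈ (baseLattice P).restrictScalars ℤ, ‖x - z‖ ≤ τ := by
  obtain ⟨y, hy, hy0, hynorm⟩ := exists_short_polarIdeal (K := K) hP0
  have hζ := IsCyclotomicExtension.zeta_spec m ℚ K
  refine exists_mem_baseLattice_norm_sub_le_of_powerBasis (hζ.powerBasis ℚ)
    (hζ.powerBasis_gen ℚ)
    (norm_embedding_eq_one_of_isPrimitiveRoot hζ.toInteger_isPrimitiveRoot) hP0 hy hy0 hτ ?_ x
  set n := finrank ℚ K
  set β := (Nat.card (𝓞 K ⧸ P) : ℝ) ^ (1 / (n : ℝ))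
  have hone : ‖planeMap (scalingFactor P) ((1, 0) : K × K)‖ ^ 2 ≤ β⁻¹ * n := by
    rw [norm_sq_planeMap, norm_sq_toMinkowski_one, map_zero, norm_zero, zero_pow two_ne_zero,
      mul_zero, add_zero]
    exact mul_le_mul_of_nonneg_right (inv_scalingFactor_sq_le hP0) (Nat.cast_nonneg _)
  have hshort : ‖planeMap (scalingFactor P) (0, y)‖ ^ 2 ≤ 4 * n * β⁻¹ := by
    rwa [norm_sq_planeMap, map_zero, norm_zero, zero_pow two_ne_zero, mul_zero, zero_add]
  calc (n : ℝ) * (‖planeMap (scalingFactor P) ((1, 0) : K × K)‖ ^ 2 +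
        ‖planeMap (scalingFactor P) (0, y)‖ ^ 2)
      ≤ n * (β⁻¹ * n + 4 * n * β⁻¹) := by gcongr
    _ = 5 * (n : ℝ) ^ 2 * β⁻¹ := by ring
    _ ≤ 4 * τ ^ 2 := hle

end CoveringRadius

section DenseLattices

open Module NumberField MeasureTheory

variable {K : Type*} [Field K] [NumberField K] {P : Ideal (𝓞 K)}

theorem finrank_minkowskiPlane : finrank ℝ (MinkowskiPlane K) = 2 * finrank ℚ K := by
  rw [(WithLp.linearEquiv 2 ℝ (MinkowskiSpace K × MinkowskiSpace K)).finrank_eq,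
    Module.finrank_prod, finrank_minkowskiSpace, two_mul]

instance : Nontrivial (MinkowskiPlane K) :=
  nontrivial_of_finrank_pos (R := ℝ)
    (by rw [finrank_minkowskiPlane]; exact Nat.mul_pos two_pos finrank_pos)

/- If every `Λ_C` had a nonzero vector shorter than `r`, the orbits of these vectors under `ζ` would
give more vectors of `Λ₀` in the ball of radius `r` than its covolume allows. -/
theorem exists_codeLattice_forall_le_norm (hP : P.IsMaximal) {m : ℕ} [NeZero m] {ζ : 𝓞 K}
    (hζ : IsPrimitiveRoot ζ m) {r τ : ℝ}
    (hlong : ∀ v ∈ P • baseModule P, v ≠ 0 → r ≤ ‖planeMap (scalingFactor P) v‖)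
    (hcover : ∀ x : MinkowskiPlane K, ∃ y ∈ (baseLattice P).restrictScalars ℤ, ‖x - y‖ ≤ τ)
    (hvol : volume.real (Metric.closedBall (0 : MinkowskiPlane K) (r + τ)) ≤ m) :
    ∃ C : Submodule (𝓞 K ⧸ P) (CodeSpace P), finrank (𝓞 K ⧸ P) C = 1 ∧
      ∀ x ∈ codeLattice P C, x ≠ 0 → r ≤ ‖x‖ := by
  classical
  by_contra! hshort
  have hP0 := ne_bot_of_isMaximal hP
  have := Ideal.finiteQuotientOfFreeOfNeBot P hP0
  have hq : (0 : ℝ) < Nat.card (𝓞 K ⧸ P) := Nat.cast_pos.mpr Nat.card_pos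
  have := discreteTopology_baseLattice hP0
  have := isZLattice_baseLattice hP0
  obtain ⟨X, hXcard, hX⟩ := exists_finset_baseLattice_card_eq hP hζ hlong hshort
  have hmem : ∀ x ∈ X, x ∈ (baseLattice P).restrictScalars ℤ := fun x hx => (hX x hx).1
  have hcard : (X.subtype (· ∈ (baseLattice P).restrictScalars ℤ)).card =
      (Nat.card (𝓞 K ⧸ P) + 1) * m := by
    rw [Finset.card_subtype, Finset.filter_true_of_mem hmem, hXcard]
  have hle := (card_mul_covolume_le_volume_closedBall _ hcover
    (X.subtype (· ∈ (baseLattice P).restrictScalars ℤ))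
    fun x hx => (hX x (Finset.mem_subtype.mp hx)).2.le).trans hvol
  rw [hcard, covolume_baseLattice hP, ← div_eq_mul_inv, div_le_iff₀ hq, mul_comm (m : ℝ)] at hle
  have hle' : (Nat.card (𝓞 K ⧸ P) + 1) * m ≤ Nat.card (𝓞 K ⧸ P) * m := mod_cast hle
  exact (Nat.mul_lt_mul_of_pos_right (Nat.lt_succ_self _) (NeZero.pos m)).not_ge hle'

variable (K) in
theorem abs_discr_le_pow_finrank_of_isCyclotomicExtension (m : ℕ) [NeZero m]
    [IsCyclotomicExtension {m} ℚ K] : |(discr K : ℝ)| ≤ (m : ℝ) ^ finrank ℚ K := by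
  rw [← Int.cast_abs, ← Nat.cast_natAbs, IsCyclotomicExtension.Rat.natAbs_discr m K,
    IsCyclotomicExtension.Rat.finrank m K]
  exact_mod_cast Nat.div_le_self _ _

theorem card_rpow_mul_finrank_le_mul_norm_sq_planeMap (m : ℕ) [NeZero m]
    [IsCyclotomicExtension {m} ℚ K] (hP0 : P ≠ ⊥) {v : K × K} (hv : v ∈ P • baseModule P)
    (hv0 : v ≠ 0) :
    (Nat.card (𝓞 K ⧸ P) : ℝ) ^ (1 / (finrank ℚ K : ℝ)) * finrank ℚ K ≤
      m * ‖planeMap (scalingFactor P) v‖ ^ 2 := by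
  have hn : 0 < finrank ℚ K := finrank_pos
  have hle := card_div_abs_discr_le_norm_sq_planeMap_div_pow hP0 hv hv0
  rw [div_le_iff₀ (zero_lt_one.trans_le one_le_abs_discr)] at hle
  rw [← le_div_iff₀ (Nat.cast_pos.mpr hn), one_div]
  refine le_of_pow_le_pow_left₀ hn.ne' (by positivity) ?_
  rw [Real.rpow_inv_natCast_pow (Nat.cast_nonneg _) hn.ne']
  calc (Nat.card (𝓞 K ⧸ P) : ℝ)
      ≤ (‖planeMap (scalingFactor P) v‖ ^ 2 / finrank ℚ K) ^ finrank ℚ K * |(discr K : ℝ)| := hle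
    _ ≤ (‖planeMap (scalingFactor P) v‖ ^ 2 / finrank ℚ K) ^ finrank ℚ K *
        (m : ℝ) ^ finrank ℚ K := by
      gcongr
      exact abs_discr_le_pow_finrank_of_isCyclotomicExtension K m
    _ = (m * ‖planeMap (scalingFactor P) v‖ ^ 2 / finrank ℚ K) ^ finrank ℚ K := by
      rw [← mul_pow]
      ring

theorem exists_codeLattice_forall_le_norm_of_isCyclotomicExtension (m : ℕ) [NeZero m]
    [IsCyclotomicExtension {m} ℚ K] (hP : P.IsMaximal) {r : ℝ} (hr : 0 ≤ r)
    {k : ℕ} (hk : finrank ℚ K = k) {Q : ℝ} (hQ : Q = (Nat.card (𝓞 K ⧸ P) : ℝ) ^ (1 / (k : ℝ)))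
    (hlong : m * r ^ 2 ≤ Q * k)
    (hvol : volume.real (Metric.closedBall (0 : MinkowskiPlane K)
      (r + √(5 / 4 * (k : ℝ) ^ 2 * Q⁻¹))) ≤ m) :
    ∃ C : Submodule (𝓞 K ⧸ P) (CodeSpace P), finrank (𝓞 K ⧸ P) C = 1 ∧
      ∀ x ∈ codeLattice P C, x ≠ 0 → r ≤ ‖x‖ := by
  subst hk hQ
  have hP0 := ne_bot_of_isMaximal hP
  refine exists_codeLattice_forall_le_norm hP
    (IsCyclotomicExtension.zeta_spec m ℚ K).toInteger_isPrimitiveRoot (fun v hv hv0 => ?_)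
    (exists_mem_baseLattice_norm_sub_le m hP0 (Real.sqrt_nonneg _) ?_) hvol
  · rw [← sq_le_sq₀ hr (norm_nonneg _)]
    exact le_of_mul_le_mul_left
      (hlong.trans (card_rpow_mul_finrank_le_mul_norm_sq_planeMap m hP0 hv hv0))
      (Nat.cast_pos.mpr (NeZero.pos m))
  · rw [Real.sq_sqrt (by positivity)]
    exact le_of_eq (by ring)

theorem exists_symplectic_packingDensity_ge (m : ℕ) [NeZero m] [IsCyclotomicExtension {m} ℚ K]
    (hP : P.IsMaximal) {k : ℕ} (hk : finrank ℚ K = k) {Q : ℝ}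
    (hQ : Q = (Nat.card (𝓞 K ⧸ P) : ℝ) ^ (1 / (k : ℝ))) (hkQ : 4 * (k : ℝ) ^ 2 * m ≤ Q)
    {T : ℝ} (hT : 1 ≤ T) (hTk : T ≤ 4 * (k : ℝ) ^ 2)
    (hTm : T * Real.exp √(45 * (k : ℝ) ^ 3 / Q) ≤ m) :
    ∃ L ∈ codeLatticeFamily P, IsSymplecticLattice L ∧ T / 2 ^ (2 * k) ≤ packingDensity L := by
  have hP0 := ne_bot_of_isMaximal hP
  have hk0 : 0 < k := hk ▸ finrank_pos
  have hdim : finrank ℝ (MinkowskiPlane K) = 2 * k := by rw [finrank_minkowskiPlane, hk]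
  have hQ0 : 0 < Q := lt_of_lt_of_le
    (mul_pos (by positivity) (Nat.cast_pos.mpr (NeZero.pos m))) hkQ
  obtain ⟨r, hr, hrT, hkr, hrk⟩ := exists_radius hk0.ne' hT hTk
  have hlong : m * r ^ 2 ≤ Q * k := by
    calc m * r ^ 2 ≤ m * (4 * (k : ℝ) ^ 3) := by gcongr
      _ = 4 * (k : ℝ) ^ 2 * m * k := by ring
      _ ≤ Q * k := by gcongr
  set τ := √(5 / 4 * (k : ℝ) ^ 2 * Q⁻¹)
  have hτ0 : 0 ≤ τ := Real.sqrt_nonneg _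
  have hvol : volume.real (Metric.closedBall (0 : MinkowskiPlane K) (r + τ)) ≤ m := by
    rw [volume_real_closedBall_of_finrank_eq_two_mul hdim (by positivity)]
    calc ((r + τ) ^ 2) ^ k * (Real.pi ^ k / k.factorial)
        ≤ (r ^ 2) ^ k * Real.exp (2 * k * τ / r) * (Real.pi ^ k / k.factorial) := by
          gcongr
          exact add_sq_pow_le_sq_pow_mul_exp hr hτ0 k
      _ = T * Real.exp (2 * k * τ / r) := by rw [← hrT]; ring
      _ ≤ T * Real.exp √(45 * (k : ℝ) ^ 3 / Q) := by
          gcongr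
          exact two_mul_sqrt_div_le_sqrt hr hkr hQ0
      _ ≤ m := hTm
  obtain ⟨C, hC, hCr⟩ :=
    exists_codeLattice_forall_le_norm_of_isCyclotomicExtension m hP hr.le hk hQ hlong hvol
  have hdensity := volume_closedBall_div_le_packingDensity
    (isEuclideanLattice_codeLattice hP0 C).2 (covolume_codeLattice hP hC) hCr
  rw [volume_real_closedBall_of_finrank_eq_two_mul hdim hr.le, hrT, hdim] at hdensity
  exact ⟨codeLattice P C, ⟨C, hC, rfl⟩, isSymplecticLattice_codeLattice hP hC, hdensity⟩

end DenseLattices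

section PrimeChoices

open Filter Asymptotics

section LiesOver

variable {K : Type*} [Field K] [NumberField K] {P : Ideal (𝓞 K)}

theorem le_card_quotient_of_liesOver (hP : P ≠ ⊤) {p : ℕ} (hp : p.Prime)
    [P.LiesOver (Ideal.span {(p : ℤ)})] : p ≤ Nat.card (𝓞 K ⧸ P) := by
  rw [← Submodule.cardQuot_apply, ← Ideal.absNorm_apply, Ideal.absNorm_eq_pow_inertiaDeg' P hp]
  refine Nat.le_self_pow (fun hdeg => hP (Ideal.absNorm_eq_one_iff.mp ?_)) p
  rw [Ideal.absNorm_eq_pow_inertiaDeg' P hp, hdeg, pow_zero]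

theorem span_natCast_ne_bot {p : ℕ} (hp : p.Prime) : Ideal.span {(p : ℤ)} ≠ ⊥ := by
  simpa only [ne_eq, Ideal.span_singleton_eq_bot, Nat.cast_eq_zero] using hp.ne_zero

theorem isMaximal_of_liesOver (hP : P.IsPrime) {p : ℕ} (hp : p.Prime)
    [P.LiesOver (Ideal.span {(p : ℤ)})] : P.IsMaximal :=
  hP.isMaximal (Ideal.ne_bot_of_liesOver_of_ne_bot (span_natCast_ne_bot hp) P)

variable (K) in
theorem exists_isPrime_not_dvd_le_card_quotient {m : ℕ} (hm : m ≠ 0) (N : ℕ) :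
    ∃ P : Ideal (𝓞 K), (P.IsPrime ∧ ∃ p : ℕ, p.Prime ∧ ¬p ∣ m ∧
      P.LiesOver (Ideal.span {(p : ℤ)})) ∧ N ≤ Nat.card (𝓞 K ⧸ P) := by
  obtain ⟨p, hmp, hp⟩ := Nat.exists_infinite_primes (m + 1 + N)
  have : (Ideal.span {(p : ℤ)}).IsMaximal :=
    ((Ideal.span_singleton_prime (Nat.cast_ne_zero.mpr hp.ne_zero)).mpr
      (Nat.prime_iff_prime_int.mp hp)).isMaximal (span_natCast_ne_bot hp)
  obtain ⟨P, hP, hPp⟩ := Ideal.exists_maximal_ideal_liesOver_of_isIntegral (S := 𝓞 K)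
    (Ideal.span {(p : ℤ)})
  have hmp' : ¬p ∣ m := fun hdvd => by
    have := Nat.le_of_dvd (Nat.pos_of_ne_zero hm) hdvd
    lia
  exact ⟨P, ⟨hP.isPrime, p, hp, hmp', hPp⟩,
    le_trans (by lia) (le_card_quotient_of_liesOver hP.ne_top hp)⟩

end LiesOver

theorem pow_four_le_rpow_one_div_totient {m : ℕ} (hm : 1 ≤ m) {q : ℝ}
    (hq : (m : ℝ) ^ (4 * m) ≤ q) : (m : ℝ) ^ 4 ≤ q ^ (1 / (m.totient : ℝ)) := by
  have hφ : 0 < m.totient := Nat.totient_pos.mpr hm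
  rw [one_div]
  have hq0 : 0 ≤ q := hq.trans' (by positivity)
  refine le_of_pow_le_pow_left₀ hφ.ne' (Real.rpow_nonneg hq0 _) ?_
  rw [Real.rpow_inv_natCast_pow hq0 hφ.ne', ← pow_mul]
  exact hq.trans' (pow_le_pow_right₀ (mod_cast hm)
    (Nat.mul_le_mul_left 4 (Nat.totient_le m)))

theorem isLittleO_totient_sq_mul {q : ℕ+ → ℝ}
    (hq : ∀ m : ℕ+, ((m : ℕ) : ℝ) ^ (4 * (m : ℕ)) ≤ q m) :
    (fun m : ℕ+ => ((m : ℕ).totient : ℝ) ^ 2 * ((m : ℕ) : ℝ)) =o[atTop]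
      fun m : ℕ+ => q m ^ (1 / ((m : ℕ).totient : ℝ)) := by
  have htop : Tendsto (fun m : ℕ+ => ((m : ℕ) : ℝ)) atTop atTop :=
    tendsto_natCast_atTop_atTop.comp tendsto_PNat_val_atTop_atTop
  have hcube : (fun m : ℕ+ => ((m : ℕ).totient : ℝ) ^ 2 * ((m : ℕ) : ℝ)) =O[atTop]
      fun m : ℕ+ => ((m : ℕ) : ℝ) ^ 3 := by
    refine .of_norm_le fun m => ?_
    rw [Real.norm_of_nonneg (by positivity), pow_succ _ 2]
    gcongr
    exact Nat.totient_le _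
  have hfour : (fun m : ℕ+ => ((m : ℕ) : ℝ) ^ 4) =O[atTop]
      fun m : ℕ+ => q m ^ (1 / ((m : ℕ).totient : ℝ)) := by
    refine .of_norm_le fun m => ?_
    rw [Real.norm_of_nonneg (by positivity)]
    exact pow_four_le_rpow_one_div_totient m.pos (hq m)
  exact hcube.trans_isLittleO
    (((isLittleO_pow_pow_atTop_of_lt (by norm_num)).comp_tendsto htop).trans_isBigO hfour)

theorem IsAdmissiblePrimeChoice.isMaximal
    {P : (m : ℕ+) → Ideal (𝓞 (CyclotomicField (m : ℕ) ℚ))} (hP : IsAdmissiblePrimeChoice P)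
    (m : ℕ+) : (P m).IsMaximal := by
  obtain ⟨hPm, p, hp, -, _⟩ := hP.1 m
  exact isMaximal_of_liesOver hPm hp

theorem exists_isAdmissiblePrimeChoice :
    ∃ P : (m : ℕ+) → Ideal (𝓞 (CyclotomicField (m : ℕ) ℚ)), IsAdmissiblePrimeChoice P := by
  choose P hP hcard using fun m : ℕ+ => exists_isPrime_not_dvd_le_card_quotient
    (CyclotomicField (m : ℕ) ℚ) m.ne_zero ((m : ℕ) ^ (4 * (m : ℕ)))
  exact ⟨P, hP, isLittleO_totient_sq_mul fun m => mod_cast hcard m⟩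

end PrimeChoices

section DensityBound

open Filter Asymptotics Topology

theorem eventually_mul_log_log_mem_Icc {c : ℝ} (hc0 : 0 < c) :
    ∀ᶠ k : ℕ in atTop, 1 ≤ c * (2 * k) * Real.log (Real.log (2 * k)) ∧
      c * (2 * k) * Real.log (Real.log (2 * k)) ≤ 4 * (k : ℝ) ^ 2 := by
  have htwo : Tendsto (fun k : ℕ => 2 * (k : ℝ)) atTop atTop :=
    tendsto_natCast_atTop_atTop.const_mul_atTop two_pos
  have hlog := Real.tendsto_log_atTop.comp (Real.tendsto_log_atTop.comp htwo)
  have hsmall := (Real.isLittleO_log_id_atTop.comp_tendsto htwo).def (inv_pos.mpr hc0)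
  filter_upwards [htwo.eventually_ge_atTop 1, htwo.eventually_ge_atTop c⁻¹,
    hlog.eventually_ge_atTop 1, hsmall] with k hk hck hk1 hksmall
  simp only [Function.comp_apply, id_eq, Real.norm_of_nonneg (Real.log_nonneg hk),
    Real.norm_of_nonneg (zero_le_one.trans hk)] at hk1 hksmall
  constructor
  · exact one_le_mul_of_one_le_of_one_le ((inv_le_iff_one_le_mul₀' hc0).mp hck) hk1
  · calc c * (2 * k) * Real.log (Real.log (2 * k))
        ≤ c * (2 * k) * (c⁻¹ * (2 * k)) := by
          gcongr
          exact (Real.log_le_self (Real.log_nonneg hk)).trans hksmall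
      _ = 4 * (k : ℝ) ^ 2 := by field_simp; ring

theorem eventually_le_and_mul_exp_sqrt_le {Q : ℕ+ → ℝ} (hQ : ∀ m, 0 ≤ Q m)
    (hlittle : (fun m : ℕ+ => ((m : ℕ).totient : ℝ) ^ 2 * ((m : ℕ) : ℝ)) =o[atTop] Q)
    {a b : ℝ} (hab : a < b) :
    ∀ᶠ m : ℕ+ in atTop, 4 * ((m : ℕ).totient : ℝ) ^ 2 * (m : ℕ) ≤ Q m ∧
      a * Real.exp √(45 * ((m : ℕ).totient : ℝ) ^ 3 / Q m) ≤ b := by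
  have hcube : (fun m : ℕ+ => 45 * ((m : ℕ).totient : ℝ) ^ 3) =o[atTop] Q := by
    refine (IsBigO.of_norm_le fun m => ?_).trans_isLittleO hlittle |>.const_mul_left 45
    rw [Real.norm_of_nonneg (by positivity), pow_succ _ 2]
    gcongr
    exact Nat.totient_le _
  have hcont : Tendsto (fun x => a * Real.exp √x) (𝓝 0) (𝓝 a) :=
    (by fun_prop : Continuous fun x => a * Real.exp √x).tendsto' 0 a
      (by rw [Real.sqrt_zero, Real.exp_zero, mul_one])
  filter_upwards [hlittle.def (by norm_num : (0 : ℝ) < 1 / 4),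
    (hcont.comp hcube.tendsto_div_nhds_zero).eventually_le_const hab] with m hm hexp
  rw [Real.norm_of_nonneg (by positivity), Real.norm_of_nonneg (hQ m)] at hm
  exact ⟨by linarith, hexp⟩

theorem exists_le_totient_and_mul_log_log_le {c : ℝ} (hc0 : 0 < c)
    (hc : c < Real.exp Real.eulerMascheroniConstant) (N : ℕ) :
    ∃ m : ℕ+, N ≤ (m : ℕ).totient ∧
      c * (m : ℕ).totient * Real.log (Real.log (2 * (m : ℕ).totient)) ≤ (m : ℕ) := by
  obtain ⟨n, hn, hN⟩ := ((frequently_mul_totient_mul_log_log_le hc0 hc).and_eventually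
    (tendsto_totient_primorial.eventually_ge_atTop N)).exists
  exact ⟨⟨primorial n, primorial_pos n⟩, hN, hn⟩

theorem exists_symplectic_packingDensity_ge_mul_log_log {c : ℝ} (hc0 : 0 < c)
    (hc : 2 * c < Real.exp Real.eulerMascheroniConstant)
    {P : (m : ℕ+) → Ideal (𝓞 (CyclotomicField (m : ℕ) ℚ))} (hP : ∀ m, (P m).IsMaximal)
    (hlittle : (fun m : ℕ+ => ((m : ℕ).totient : ℝ) ^ 2 * ((m : ℕ) : ℝ)) =o[atTop]
      fun m : ℕ+ => (Nat.card (𝓞 (CyclotomicField (m : ℕ) ℚ) ⧸ P m) : ℝ) ^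
        (1 / ((m : ℕ).totient : ℝ))) (N : ℕ) :
    ∃ m : ℕ+, N ≤ (m : ℕ).totient ∧ ∃ L ∈ codeLatticeFamily (P m), IsSymplecticLattice L ∧
      c * (2 * (m : ℕ).totient) * Real.log (Real.log (2 * (m : ℕ).totient)) /
        2 ^ (2 * (m : ℕ).totient) ≤ packingDensity L := by
  obtain ⟨b, hcb, hb⟩ := exists_between hc
  obtain ⟨M, hM⟩ := eventually_atTop.mp
    (eventually_le_and_mul_exp_sqrt_le (fun m => by positivity) hlittle hcb)
  obtain ⟨N', hN'⟩ := eventually_atTop.mp (eventually_mul_log_log_mem_Icc hc0)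
  obtain ⟨m, hφ, hratio⟩ :=
    exists_le_totient_and_mul_log_log_le (hcb.trans' (by positivity)) hb (N + M + N')
  have hMm : M ≤ m := (PNat.coe_le_coe M m).mp (by have := (m : ℕ).totient_le; lia)
  obtain ⟨hQ, hexp⟩ := hM m hMm
  obtain ⟨hT, hTφ⟩ := hN' (m : ℕ).totient (by lia)
  have : IsCyclotomicExtension {(m : ℕ)} ℚ (CyclotomicField (m : ℕ) ℚ) :=
    CyclotomicField.isCyclotomicExtension (m : ℕ) ℚ
  refine ⟨m, by lia, exists_symplectic_packingDensity_ge (m : ℕ) (hP m)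
    (IsCyclotomicExtension.Rat.finrank (m : ℕ) _) rfl hQ hT hTφ (hratio.trans' ?_)⟩
  set φ : ℝ := ((m : ℕ).totient : ℝ)
  have hφlog : 0 ≤ φ * Real.log (Real.log (2 * φ)) :=
    nonneg_of_mul_nonneg_right (hT.trans' zero_le_one |>.trans_eq (by ring))
      (mul_pos two_pos hc0)
  calc _ = 2 * c * Real.exp _ * (φ * Real.log (Real.log (2 * φ))) := by ring
    _ ≤ b * (φ * Real.log (Real.log (2 * φ))) := mul_le_mul_of_nonneg_right hexp hφlog
    _ = b * φ * Real.log (Real.log (2 * φ)) := (mul_assoc _ _ _).symm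

end DensityBound

theorem mainTheorem6_general {c : ℝ} (hc0 : 0 < c)
    (hc : 2 * c < Real.exp Real.eulerMascheroniConstant)
    {P : (m : ℕ+) → Ideal (𝓞 (CyclotomicField (m : ℕ) ℚ))} (hP : ∀ m, (P m).IsMaximal)
    (hlittle : (fun m : ℕ+ => ((m : ℕ).totient : ℝ) ^ 2 * ((m : ℕ) : ℝ)) =o[Filter.atTop]
      fun m : ℕ+ => (Nat.card (𝓞 (CyclotomicField (m : ℕ) ℚ) ⧸ P m) : ℝ) ^
        (1 / ((m : ℕ).totient : ℝ))) :
    {n : ℕ | ∃ m : ℕ+,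
      Module.finrank ℝ (MinkowskiPlane (CyclotomicField (m : ℕ) ℚ)) = n ∧
      n = 2 * (m : ℕ).totient ∧
      ∃ L ∈ codeLatticeFamily (P m), IsSymplecticLattice L ∧
        packingDensity L ≥ c * n * Real.log (Real.log n) / 2 ^ n}.Infinite := by
  refine Set.infinite_of_forall_exists_gt fun a => ?_
  obtain ⟨m, hm, L, hL, hsymplectic, hdensity⟩ :=
    exists_symplectic_packingDensity_ge_mul_log_log hc0 hc hP hlittle (a + 1)
  have : IsCyclotomicExtension {(m : ℕ)} ℚ (CyclotomicField (m : ℕ) ℚ) :=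
    CyclotomicField.isCyclotomicExtension (m : ℕ) ℚ
  refine ⟨2 * (m : ℕ).totient, ⟨m, ?_, rfl, L, hL, hsymplectic, mod_cast hdensity⟩, by lia⟩
  rw [finrank_minkowskiPlane, IsCyclotomicExtension.Rat.finrank (m : ℕ)]

theorem mainTheorem6 :
    (∃ P : (m : ℕ+) → Ideal (𝓞 (CyclotomicField (m : ℕ) ℚ)), IsAdmissiblePrimeChoice P) ∧
    ∀ P : (m : ℕ+) → Ideal (𝓞 (CyclotomicField (m : ℕ) ℚ)), IsAdmissiblePrimeChoice P →
      {n : ℕ | ∃ m : ℕ+,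
        Module.finrank ℝ (MinkowskiPlane (CyclotomicField (m : ℕ) ℚ)) = n ∧
        n = 2 * (m : ℕ).totient ∧
        ∃ L ∈ codeLatticeFamily (P m), IsSymplecticLattice L ∧
          packingDensity L ≥ 0.89 * n * Real.log (Real.log n) / 2 ^ n}.Infinite :=
  ⟨exists_isAdmissiblePrimeChoice, fun _ hP => mainTheorem6_general (by norm_num)
    (lt_exp_eulerMascheroniConstant.trans_eq' (by norm_num)) hP.isMaximal hP.2⟩
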